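/- Let $\mathbb{O}=\mathbb{H}\oplus\mathbb{H}\mathbf{l}$ be the real octonion division algebra, with product determined by $q_1(q_2\mathbf{l})=(q_2q_1)\mathbf{l}$, $(q_2\mathbf{l})q_1=(q_2\overline{q_1})\mathbf{l}$, $(q_1\mathbf{l})(q_2\mathbf{l})=-\overline{q_2}q_1$ for $q_1,q_2\in\mathbb{H}$, and let $\mathfrak{g}_2=\mathfrak{der}(\mathbb{O})$ be the compact real Lie algebra of derivations of $\mathbb{O}$. In a complex semisimple Lie algebra $\mathfrak{g}$, an ($\mathrm{ad}$-)nilpotent element $e$ is called principal if $\dim_{\mathbb{C}}\{x\in\mathfrak{g}:[x,e]=0\}=\operatorname{rank}\mathfrak{g}$, and a principal subalgebra is the span of an $\mathfrak{sl}_2$-triple $\{e,h,f\}$ (that is, $h\neq 0$, $[h,e]=2e$, $[h,f]=-2f$, $[e,f]=h$) with $e$ a principal nilpotent element. A three-dimensional simple subalgebra $\mathfrak{s}$ of a simple compact real Lie algebra $\mathfrak{g}$ is called principal if its complexification $\mathfrak{s}\otimes_{\mathbb{R}}\mathbb{C}$ is a principal subalgebra of $\mathfrak{g}\otimes_{\mathbb{R}}\mathbb{C}$.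 Then, up to conjugation by an automorphism of $\mathfrak{g}_2$, there is exactly one principal three-dimensional simple subalgebra of $\mathfrak{g}_2$: such a subalgebra exists, and for any two principal three-dimensional simple subalgebras $\mathfrak{s},\mathfrak{s}'$ of $\mathfrak{g}_2$ there is a Lie algebra automorphism $\varphi$ of $\mathfrak{g}_2$ with $\varphi(\mathfrak{s})=\mathfrak{s}'$. -/

import Mathlib

open scoped TensorProduct Quaternion

-- The bracket of an associative algebra is its commutator.
attribute [local instance 100] LieRing.ofAssociativeRing

/-- The real octonion division algebra `𝕆 = ℍ ⊕ ℍ𝐥`; the pair `(a, b)` stands for `a + b𝐥`. -/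
def Octonion : Type := ℍ[ℝ] × ℍ[ℝ]

namespace Octonion

noncomputable instance : AddCommGroup Octonion := inferInstanceAs (AddCommGroup (ℍ[ℝ] × ℍ[ℝ]))

noncomputable instance : Module ℝ Octonion := inferInstanceAs (Module ℝ (ℍ[ℝ] × ℍ[ℝ]))

instance : Module.Finite ℝ Octonion := inferInstanceAs (Module.Finite ℝ (ℍ[ℝ] × ℍ[ℝ]))

noncomputable instance : One Octonion := ⟨((1 : ℍ[ℝ]), (0 : ℍ[ℝ]))⟩

/-- The octonion product, determined by the rules `p(q𝐥) = (qp)𝐥`,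
`(q𝐥)p = (q p̄)𝐥` and `(p𝐥)(q𝐥) = -q̄ p` for quaternions `p`, `q`. -/
noncomputable instance : Mul Octonion :=
  ⟨fun x y => (x.1 * y.1 - star y.2 * x.2, y.2 * x.1 + x.2 * star y.1)⟩

theorem mul_def (x y : Octonion) :
    x * y = (x.1 * y.1 - star y.2 * x.2, y.2 * x.1 + x.2 * star y.1) := rfl

noncomputable instance : NonAssocRing Octonion :=
  { (inferInstance : AddCommGroup Octonion), (inferInstance : Mul Octonion),
    (inferInstance : One Octonion) with
    left_distrib := fun x y z => Prod.ext
      (show x.1 * (y.1 + z.1) - star (y.2 + z.2) * x.2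
        = (x.1 * y.1 - star y.2 * x.2) + (x.1 * z.1 - star z.2 * x.2) by
          rw [star_add, mul_add, add_mul]; abel)
      (show (y.2 + z.2) * x.1 + x.2 * star (y.1 + z.1)
        = (y.2 * x.1 + x.2 * star y.1) + (z.2 * x.1 + x.2 * star z.1) by
          rw [star_add, mul_add, add_mul]; abel)
    right_distrib := fun x y z => Prod.ext
      (show (x.1 + y.1) * z.1 - star z.2 * (x.2 + y.2)
        = (x.1 * z.1 - star z.2 * x.2) + (y.1 * z.1 - star z.2 * y.2) by
          rw [mul_add, add_mul]; abel)
      (show z.2 * (x.1 + y.1) + (x.2 + y.2) * star z.1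
        = (z.2 * x.1 + x.2 * star z.1) + (z.2 * y.1 + y.2 * star z.1) by
          rw [mul_add, add_mul]; abel)
    zero_mul := fun x => Prod.ext
      (show (0 : ℍ[ℝ]) * x.1 - star x.2 * 0 = 0 by rw [zero_mul, mul_zero, sub_zero])
      (show x.2 * (0 : ℍ[ℝ]) + 0 * star x.1 = 0 by rw [zero_mul, mul_zero, add_zero])
    mul_zero := fun x => Prod.ext
      (show x.1 * (0 : ℍ[ℝ]) - star 0 * x.2 = 0 by rw [star_zero, zero_mul, mul_zero, sub_zero])
      (show (0 : ℍ[ℝ]) * x.1 + x.2 * star 0 = 0 by rw [star_zero, zero_mul, mul_zero, add_zero])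
    one_mul := fun x => Prod.ext
      (show (1 : ℍ[ℝ]) * x.1 - star x.2 * 0 = x.1 by rw [one_mul, mul_zero, sub_zero])
      (show x.2 * (1 : ℍ[ℝ]) + 0 * star x.1 = x.2 by rw [mul_one, zero_mul, add_zero])
    mul_one := fun x => Prod.ext
      (show x.1 * (1 : ℍ[ℝ]) - star 0 * x.2 = x.1 by rw [star_zero, mul_one, zero_mul, sub_zero])
      (show (0 : ℍ[ℝ]) * x.1 + x.2 * star 1 = x.2 by
        rw [star_one, zero_mul, mul_one, zero_add]) }

end Octonion

/-- The Lie algebra `𝔡𝔢𝔯(A) = {d ∈ 𝔤𝔩(A) : d(xy) = d(x)y + x d(y)}` of derivations of a not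
necessarily associative algebra `A`, with the commutator as bracket. -/
def derivationAlgebra (R A : Type*) [CommRing R] [NonUnitalNonAssocRing A] [Module R A]
    [IsScalarTower R A A] [SMulCommClass R A A] : LieSubalgebra R (Module.End R A) where
  carrier := {d | ∀ x y : A, d (x * y) = d x * y + x * d y}
  add_mem' := by
    intro c d hc hd x y
    simp only [LinearMap.add_apply, hc x y, hd x y, add_mul, mul_add]
    abel
  zero_mem' := by
    intro x y
    simp only [LinearMap.zero_apply, zero_mul, mul_zero, add_zero]
  smul_mem' := by
    intro r d hd x y
    simp only [LinearMap.smul_apply, hd x y, smul_add, smul_mul_assoc, mul_smul_comm]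
  lie_mem' := by
    intro c d hc hd x y
    have hc' : ∀ x y : A, c (x * y) = c x * y + x * c y := hc
    have hd' : ∀ x y : A, d (x * y) = d x * y + x * d y := hd
    simp only [Ring.lie_def, LinearMap.sub_apply, Module.End.mul_apply, hc', hd', map_add,
      sub_mul, mul_sub]
    abel

namespace Octonion

instance : IsScalarTower ℝ Octonion Octonion :=
  ⟨fun r x y => Prod.ext
    (show (r • x.1) * y.1 - star y.2 * (r • x.2) = r • (x.1 * y.1 - star y.2 * x.2) by
      rw [smul_mul_assoc, mul_smul_comm, smul_sub])
    (show y.2 * (r • x.1) + (r • x.2) * star y.1 = r • (y.2 * x.1 + x.2 * star y.1) by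
      rw [smul_mul_assoc, mul_smul_comm, smul_add])⟩

instance : SMulCommClass ℝ Octonion Octonion :=
  ⟨fun r x y => Prod.ext
    (show r • (x.1 * y.1 - star y.2 * x.2) = x.1 * (r • y.1) - star (r • y.2) * x.2 by
      rw [Quaternion.star_smul, smul_mul_assoc, mul_smul_comm, smul_sub])
    (show r • (y.2 * x.1 + x.2 * star y.1) = (r • y.2) * x.1 + x.2 * star (r • y.1) by
      rw [Quaternion.star_smul, smul_mul_assoc, mul_smul_comm, smul_add])⟩

end Octonion

/-- The compact real exceptional Lie algebra `𝔤₂ = 𝔡𝔢𝔯(𝕆)`. -/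
noncomputable abbrev CompactG2 : LieSubalgebra ℝ (Module.End ℝ Octonion) := derivationAlgebra ℝ Octonion

/-- The complexification `s^ℂ = ℂ ⊗ s`, as a subalgebra of the complex Lie algebra `L^ℂ = ℂ ⊗ L`. -/
noncomputable def complexification {L : Type*} [LieRing L] [LieAlgebra ℝ L]
    (s : LieSubalgebra ℝ L) : LieSubalgebra ℂ (ℂ ⊗[ℝ] L) :=
  { s.toSubmodule.baseChange ℂ with
    lie_mem' := by
      intro x y hx hy
      have hx' : x ∈ s.toSubmodule.baseChange ℂ := hx
      have hy' : y ∈ s.toSubmodule.baseChange ℂ := hy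
      change ⁅x, y⁆ ∈ s.toSubmodule.baseChange ℂ
      clear hx hy
      rw [Submodule.baseChange_eq_span] at hx' hy'
      induction hx' using Submodule.span_induction with
      | zero => rw [zero_lie]; exact Submodule.zero_mem _
      | add u v _ _ hu hv => rw [add_lie]; exact Submodule.add_mem _ hu hv
      | smul c u _ hu => rw [smul_lie]; exact Submodule.smul_mem _ c hu
      | mem u hu =>
        induction hy' using Submodule.span_induction with
        | zero =>
          have e : ⁅u, (0 : ℂ ⊗[ℝ] L)⁆ = 0 := lie_zero u
          rw [e]; exact Submodule.zero_mem _
        | add v w _ _ hv hw =>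
          have e : ⁅u, v + w⁆ = ⁅u, v⁆ + ⁅u, w⁆ := lie_add u v w
          rw [e]; exact Submodule.add_mem _ hv hw
        | smul c v _ hv =>
          have e : ⁅u, c • v⁆ = c • ⁅u, v⁆ := lie_smul c u v
          rw [e]; exact Submodule.smul_mem _ c hv
        | mem v hv =>
          obtain ⟨a, ha, rfl⟩ := hu
          obtain ⟨b, hb, rfl⟩ := hv
          rw [TensorProduct.mk_apply, TensorProduct.mk_apply,
            LieAlgebra.ExtendScalars.bracket_tmul]
          exact Submodule.tmul_mem_baseChange_of_mem _ (s.lie_mem ha hb) }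

/-- A nilpotent element `e` of a complex semisimple Lie algebra `L` is principal if the dimension
of its centralizer `{x : [e, x] = 0}` equals the rank of `L`. -/
def IsPrincipalNilpotent {L : Type*} [LieRing L] [LieAlgebra ℂ L] [Module.Finite ℂ L]
    (e : L) : Prop :=
  IsNilpotent (LieAlgebra.ad ℂ L e) ∧
    Module.finrank ℂ (LinearMap.ker (LieAlgebra.ad ℂ L e)) = LieAlgebra.rank ℂ L

/-- A principal subalgebra of a complex semisimple Lie algebra: the span of an `𝔰𝔩₂`-triple
`{e, h, f}` with `e` a principal nilpotent element. -/
def IsPrincipalSubalgebra {L : Type*} [LieRing L] [LieAlgebra ℂ L] [Module.Finite ℂ L]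
    (s : LieSubalgebra ℂ L) : Prop :=
  ∃ h e f : L, IsSl2Triple h e f ∧ IsPrincipalNilpotent e ∧
    s.toSubmodule = Submodule.span ℂ {e, h, f}

/-- A principal three-dimensional simple subalgebra of a (simple compact) real Lie algebra `L`: a
three-dimensional simple subalgebra whose complexification is a principal subalgebra of
`ℂ ⊗ L`. -/
structure IsPrincipalTDS {L : Type*} [LieRing L] [LieAlgebra ℝ L] [Module.Finite ℝ L]
    (s : LieSubalgebra ℝ L) : Prop where
  finrank_eq : Module.finrank ℝ s = 3
  isSimple : LieAlgebra.IsSimple ℝ s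
  isPrincipal : IsPrincipalSubalgebra (complexification s)

/-! Inside a compact algebra a principal three-dimensional subalgebra can be put in the form [H,X] =
Y, [X,Y] = H, [Y,H] = X, and then e = X + iY satisfies [2iH, e] = 2e. The representation theory of
such a pair gives dim ker ad(2iH) ≤ dim ker ad e. Since 𝔤₂ has rank 2, principality of e forces the
centralizer of H to have dimension at most two (`HasSmallCentralizer`). This is the only consequence
of principality used for uniqueness: from there on the argument takes place in real octonion
geometry.

A derivation is skew on the seven-dimensional space of imaginary octonions, so H kills a unit vector
v. The small centralizer prevents H from killing any vector outside the line of v in that space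
(`HasSmallCentralizer.eq_zero_of_der_eq_zero`). A trace identity shows Xv ≠ 0, since otherwise the
triple would act on the complex 3-space orthogonal to 1 and v with H of nonzero determinant, which
𝔰𝔬(3) does not allow. After a change of sign of v, H(Xv) = v(Xv). Take i = v and j along Xv. The
part of Xj orthogonal to i is a nonzero vector w orthogonal to the quaternions, with Hw = 2iw, and l
is taken along w. Automorphisms of 𝕆 act transitively on such frames (`IsBasicTriple.exists_isAut`),
so after conjugation H = `torusDer 1 2` and X = `mixedDer s r` with s, r > 0. The relation [X,Y] = H
leaves only s² = 6 and r² = 5/2. Hence all these triples are conjugate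
(`HasSmallCentralizer.exists_conj_eq_standard`).

The same normal form provides existence. The centralizer of its e is bounded above by solving a
linear system (`centralizer_mixedDer`) and below by the torus commuting with H. The rank is found
over ℝ, where the Engel subalgebra of an element is its centralizer because -tr(AB) is positive
definite and invariant, and is then carried to ℂ by base change. -/

namespace Octonion

/-! ### Octonions in coordinates: inner product, alternative laws -/

/-- The octonion with the given real coordinates with respect to `1, i, j, k, l, il, jl, kl`. -/
def mk (a b c d e f g h : ℝ) : Octonion := ((⟨a, b, c, d⟩ : ℍ[ℝ]), (⟨e, f, g, h⟩ : ℍ[ℝ]))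

/-- A real coordinate of an octonion. -/
def c0 (x : Octonion) : ℝ := x.1.re
/-- A real coordinate of an octonion. -/
def c1 (x : Octonion) : ℝ := x.1.imI
/-- A real coordinate of an octonion. -/
def c2 (x : Octonion) : ℝ := x.1.imJ
/-- A real coordinate of an octonion. -/
def c3 (x : Octonion) : ℝ := x.1.imK
/-- A real coordinate of an octonion. -/
def c4 (x : Octonion) : ℝ := x.2.re
/-- A real coordinate of an octonion. -/
def c5 (x : Octonion) : ℝ := x.2.imI
/-- A real coordinate of an octonion. -/
def c6 (x : Octonion) : ℝ := x.2.imJ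
/-- A real coordinate of an octonion. -/
def c7 (x : Octonion) : ℝ := x.2.imK

section coordinates

variable (x y : Octonion) (r a0 a1 a2 a3 a4 a5 a6 a7 : ℝ)

@[simp] theorem c0_mk : (mk a0 a1 a2 a3 a4 a5 a6 a7).c0 = a0 := rfl
@[simp] theorem c0_add : (x + y).c0 = x.c0 + y.c0 := rfl
@[simp] theorem c0_sub : (x - y).c0 = x.c0 - y.c0 := rfl
@[simp] theorem c0_neg : (-x).c0 = -x.c0 := rfl
@[simp] theorem c0_smul : (r • x).c0 = r * x.c0 := rfl
@[simp] theorem c0_zero : (0 : Octonion).c0 = 0 := rfl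
@[simp] theorem c0_one : (1 : Octonion).c0 = 1 := rfl
@[simp] theorem c0_mul : (x * y).c0 = x.c0 * y.c0 - x.c1 * y.c1 - x.c2 * y.c2 - x.c3 * y.c3
    - x.c4 * y.c4 - x.c5 * y.c5 - x.c6 * y.c6 - x.c7 * y.c7 := by
  simp [c0, c1, c2, c3, c4, c5, c6, c7, mul_def]; ring
@[simp] theorem c1_mk : (mk a0 a1 a2 a3 a4 a5 a6 a7).c1 = a1 := rfl
@[simp] theorem c1_add : (x + y).c1 = x.c1 + y.c1 := rfl
@[simp] theorem c1_sub : (x - y).c1 = x.c1 - y.c1 := rfl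
@[simp] theorem c1_neg : (-x).c1 = -x.c1 := rfl
@[simp] theorem c1_smul : (r • x).c1 = r * x.c1 := rfl
@[simp] theorem c1_zero : (0 : Octonion).c1 = 0 := rfl
@[simp] theorem c1_one : (1 : Octonion).c1 = 0 := rfl
@[simp] theorem c1_mul : (x * y).c1 = x.c0 * y.c1 + x.c1 * y.c0 + x.c2 * y.c3 - x.c3 * y.c2
    + x.c4 * y.c5 - x.c5 * y.c4 - x.c6 * y.c7 + x.c7 * y.c6 := by
  simp [c0, c1, c2, c3, c4, c5, c6, c7, mul_def]; ring
@[simp] theorem c2_mk : (mk a0 a1 a2 a3 a4 a5 a6 a7).c2 = a2 := rfl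
@[simp] theorem c2_add : (x + y).c2 = x.c2 + y.c2 := rfl
@[simp] theorem c2_sub : (x - y).c2 = x.c2 - y.c2 := rfl
@[simp] theorem c2_neg : (-x).c2 = -x.c2 := rfl
@[simp] theorem c2_smul : (r • x).c2 = r * x.c2 := rfl
@[simp] theorem c2_zero : (0 : Octonion).c2 = 0 := rfl
@[simp] theorem c2_one : (1 : Octonion).c2 = 0 := rfl
@[simp] theorem c2_mul : (x * y).c2 = x.c0 * y.c2 - x.c1 * y.c3 + x.c2 * y.c0 + x.c3 * y.c1
    + x.c4 * y.c6 + x.c5 * y.c7 - x.c6 * y.c4 - x.c7 * y.c5 := by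
  simp [c0, c1, c2, c3, c4, c5, c6, c7, mul_def]; ring
@[simp] theorem c3_mk : (mk a0 a1 a2 a3 a4 a5 a6 a7).c3 = a3 := rfl
@[simp] theorem c3_add : (x + y).c3 = x.c3 + y.c3 := rfl
@[simp] theorem c3_sub : (x - y).c3 = x.c3 - y.c3 := rfl
@[simp] theorem c3_neg : (-x).c3 = -x.c3 := rfl
@[simp] theorem c3_smul : (r • x).c3 = r * x.c3 := rfl
@[simp] theorem c3_zero : (0 : Octonion).c3 = 0 := rfl
@[simp] theorem c3_one : (1 : Octonion).c3 = 0 := rfl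
@[simp] theorem c3_mul : (x * y).c3 = x.c0 * y.c3 + x.c1 * y.c2 - x.c2 * y.c1 + x.c3 * y.c0
    + x.c4 * y.c7 - x.c5 * y.c6 + x.c6 * y.c5 - x.c7 * y.c4 := by
  simp [c0, c1, c2, c3, c4, c5, c6, c7, mul_def]; ring
@[simp] theorem c4_mk : (mk a0 a1 a2 a3 a4 a5 a6 a7).c4 = a4 := rfl
@[simp] theorem c4_add : (x + y).c4 = x.c4 + y.c4 := rfl
@[simp] theorem c4_sub : (x - y).c4 = x.c4 - y.c4 := rfl
@[simp] theorem c4_neg : (-x).c4 = -x.c4 := rfl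
@[simp] theorem c4_smul : (r • x).c4 = r * x.c4 := rfl
@[simp] theorem c4_zero : (0 : Octonion).c4 = 0 := rfl
@[simp] theorem c4_one : (1 : Octonion).c4 = 0 := rfl
@[simp] theorem c4_mul : (x * y).c4 = x.c0 * y.c4 - x.c1 * y.c5 - x.c2 * y.c6 - x.c3 * y.c7
    + x.c4 * y.c0 + x.c5 * y.c1 + x.c6 * y.c2 + x.c7 * y.c3 := by
  simp [c0, c1, c2, c3, c4, c5, c6, c7, mul_def]; ring
@[simp] theorem c5_mk : (mk a0 a1 a2 a3 a4 a5 a6 a7).c5 = a5 := rfl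
@[simp] theorem c5_add : (x + y).c5 = x.c5 + y.c5 := rfl
@[simp] theorem c5_sub : (x - y).c5 = x.c5 - y.c5 := rfl
@[simp] theorem c5_neg : (-x).c5 = -x.c5 := rfl
@[simp] theorem c5_smul : (r • x).c5 = r * x.c5 := rfl
@[simp] theorem c5_zero : (0 : Octonion).c5 = 0 := rfl
@[simp] theorem c5_one : (1 : Octonion).c5 = 0 := rfl
@[simp] theorem c5_mul : (x * y).c5 = x.c0 * y.c5 + x.c1 * y.c4 - x.c2 * y.c7 + x.c3 * y.c6
    - x.c4 * y.c1 + x.c5 * y.c0 - x.c6 * y.c3 + x.c7 * y.c2 := by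
  simp [c0, c1, c2, c3, c4, c5, c6, c7, mul_def]; ring
@[simp] theorem c6_mk : (mk a0 a1 a2 a3 a4 a5 a6 a7).c6 = a6 := rfl
@[simp] theorem c6_add : (x + y).c6 = x.c6 + y.c6 := rfl
@[simp] theorem c6_sub : (x - y).c6 = x.c6 - y.c6 := rfl
@[simp] theorem c6_neg : (-x).c6 = -x.c6 := rfl
@[simp] theorem c6_smul : (r • x).c6 = r * x.c6 := rfl
@[simp] theorem c6_zero : (0 : Octonion).c6 = 0 := rfl
@[simp] theorem c6_one : (1 : Octonion).c6 = 0 := rfl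
@[simp] theorem c6_mul : (x * y).c6 = x.c0 * y.c6 + x.c1 * y.c7 + x.c2 * y.c4 - x.c3 * y.c5
    - x.c4 * y.c2 + x.c5 * y.c3 + x.c6 * y.c0 - x.c7 * y.c1 := by
  simp [c0, c1, c2, c3, c4, c5, c6, c7, mul_def]; ring
@[simp] theorem c7_mk : (mk a0 a1 a2 a3 a4 a5 a6 a7).c7 = a7 := rfl
@[simp] theorem c7_add : (x + y).c7 = x.c7 + y.c7 := rfl
@[simp] theorem c7_sub : (x - y).c7 = x.c7 - y.c7 := rfl
@[simp] theorem c7_neg : (-x).c7 = -x.c7 := rfl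
@[simp] theorem c7_smul : (r • x).c7 = r * x.c7 := rfl
@[simp] theorem c7_zero : (0 : Octonion).c7 = 0 := rfl
@[simp] theorem c7_one : (1 : Octonion).c7 = 0 := rfl
@[simp] theorem c7_mul : (x * y).c7 = x.c0 * y.c7 - x.c1 * y.c6 + x.c2 * y.c5 + x.c3 * y.c4
    - x.c4 * y.c3 - x.c5 * y.c2 + x.c6 * y.c1 + x.c7 * y.c0 := by
  simp [c0, c1, c2, c3, c4, c5, c6, c7, mul_def]; ring

end coordinates

@[ext]
theorem ext_coord {x y : Octonion} (h0 : x.c0 = y.c0) (h1 : x.c1 = y.c1) (h2 : x.c2 = y.c2) (h3 : x.c3 = y.c3)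
    (h4 : x.c4 = y.c4) (h5 : x.c5 = y.c5) (h6 : x.c6 = y.c6) (h7 : x.c7 = y.c7) : x = y :=
  Prod.ext (QuaternionAlgebra.ext h0 h1 h2 h3) (QuaternionAlgebra.ext h4 h5 h6 h7)

/-- The imaginary unit `i`. -/
def uI : Octonion := mk 0 1 0 0 0 0 0 0
/-- The imaginary unit `j`. -/
def uJ : Octonion := mk 0 0 1 0 0 0 0 0
/-- The imaginary unit `k = ij`. -/
def uK : Octonion := mk 0 0 0 1 0 0 0 0
/-- The imaginary unit `l`. -/
def uL : Octonion := mk 0 0 0 0 1 0 0 0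
/-- The imaginary unit `il`. -/
def uIL : Octonion := mk 0 0 0 0 0 1 0 0
/-- The imaginary unit `jl`. -/
def uJL : Octonion := mk 0 0 0 0 0 0 1 0
/-- The imaginary unit `kl`. -/
def uKL : Octonion := mk 0 0 0 0 0 0 0 1

theorem eq_sum (x : Octonion) : x = x.c0 • (1 : Octonion) + x.c1 • uI + x.c2 • uJ
    + x.c3 • uK + x.c4 • uL + x.c5 • uIL + x.c6 • uJL + x.c7 • uKL := by
  apply ext_coord <;> simp [uI, uJ, uK, uL, uIL, uJL, uKL]

theorem uI_mul_uJ : uI * uJ = uK := by apply ext_coord <;> simp [uI, uJ, uK]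
theorem uI_mul_uL : uI * uL = uIL := by apply ext_coord <;> simp [uI, uL, uIL]
theorem uJ_mul_uL : uJ * uL = uJL := by apply ext_coord <;> simp [uJ, uL, uJL]
theorem uK_mul_uL : uK * uL = uKL := by apply ext_coord <;> simp [uK, uL, uKL]

/-- The standard inner product of the octonions. -/
def dot (x y : Octonion) : ℝ := x.c0 * y.c0 + x.c1 * y.c1 + x.c2 * y.c2
  + x.c3 * y.c3 + x.c4 * y.c4 + x.c5 * y.c5 + x.c6 * y.c6 + x.c7 * y.c7

theorem dot_comm (x y : Octonion) : dot x y = dot y x := by simp only [dot]; ring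
theorem dot_add_left (x y z : Octonion) : dot (x + y) z = dot x z + dot y z := by
  simp [dot]; ring
theorem dot_add_right (x y z : Octonion) : dot z (x + y) = dot z x + dot z y := by
  simp [dot]; ring
theorem dot_sub_left (x y z : Octonion) : dot (x - y) z = dot x z - dot y z := by
  simp [dot]; ring
theorem dot_sub_right (x y z : Octonion) : dot z (x - y) = dot z x - dot z y := by
  simp [dot]; ring
theorem dot_neg_left (x z : Octonion) : dot (-x) z = -dot x z := by
  simp [dot]; ring
theorem dot_neg_right (x z : Octonion) : dot z (-x) = -dot z x := by
  simp [dot]; ring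
theorem dot_smul_left (r : ℝ) (x z : Octonion) : dot (r • x) z = r * dot x z := by
  simp [dot]; ring
theorem dot_smul_right (r : ℝ) (x z : Octonion) : dot z (r • x) = r * dot z x := by
  simp [dot]; ring
@[simp] theorem dot_zero_left (z : Octonion) : dot 0 z = 0 := by simp [dot]
@[simp] theorem dot_zero_right (z : Octonion) : dot z 0 = 0 := by simp [dot]

theorem dot_self_nonneg (x : Octonion) : 0 ≤ dot x x := by
  simp only [dot]; nlinarith [mul_self_nonneg x.c0, mul_self_nonneg x.c1,
    mul_self_nonneg x.c2, mul_self_nonneg x.c3, mul_self_nonneg x.c4,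
    mul_self_nonneg x.c5, mul_self_nonneg x.c6, mul_self_nonneg x.c7]

theorem eq_zero_of_dot_self {x : Octonion} (h : dot x x = 0) : x = 0 := by
  simp only [dot] at h
  have h0 := mul_self_nonneg x.c0
  have h1 := mul_self_nonneg x.c1
  have h2 := mul_self_nonneg x.c2
  have h3 := mul_self_nonneg x.c3
  have h4 := mul_self_nonneg x.c4
  have h5 := mul_self_nonneg x.c5
  have h6 := mul_self_nonneg x.c6
  have h7 := mul_self_nonneg x.c7
  apply ext_coord <;> refine mul_self_eq_zero.1 (?_ : _ = (0 : ℝ)) <;> linarith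

theorem dot_self_pos {x : Octonion} (h : x ≠ 0) : 0 < dot x x :=
  lt_of_le_of_ne (dot_self_nonneg x) fun h' => h (eq_zero_of_dot_self h'.symm)

theorem dot_one_right (x : Octonion) : dot x 1 = x.c0 := by simp [dot]

theorem mul_add_mul_comm_of_imag {x y : Octonion} (hx : dot x 1 = 0) (hy : dot y 1 = 0) :
    x * y + y * x = (-(2 * dot x y)) • (1 : Octonion) := by
  rw [dot_one_right] at hx hy
  apply ext_coord <;> simp [dot, hx, hy] <;> ring

theorem anticomm {x y : Octonion} (hx : dot x 1 = 0) (hy : dot y 1 = 0) (h : dot x y = 0) :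
    y * x = -(x * y) := by
  have := mul_add_mul_comm_of_imag hx hy
  rw [h] at this
  rw [eq_neg_iff_add_eq_zero, add_comm]
  simpa using this

theorem mul_self_of_imag {x : Octonion} (hx : dot x 1 = 0) :
    x * x = (-dot x x) • (1 : Octonion) := by
  rw [dot_one_right] at hx
  apply ext_coord <;> simp [dot, hx] <;> ring

theorem dot_mul_mul_left (x y z : Octonion) : dot (x * y) (x * z) = dot x x * dot y z := by
  simp only [dot, c0_mul, c1_mul, c2_mul, c3_mul, c4_mul, c5_mul, c6_mul, c7_mul]; ring

theorem dot_mul_mul_right (x y z : Octonion) : dot (y * x) (z * x) = dot x x * dot y z := by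
  simp only [dot, c0_mul, c1_mul, c2_mul, c3_mul, c4_mul, c5_mul, c6_mul, c7_mul]; ring

theorem dot_mul_one (x y : Octonion) (hx : dot x 1 = 0) : dot (x * y) 1 = -dot x y := by
  rw [dot_one_right] at hx
  simp [dot, hx]; ring

/-- The linearized left alternative law. -/
theorem left_alternative (x y z : Octonion) :
    x * (y * z) + y * (x * z) = (x * y + y * x) * z := by
  apply ext_coord <;> simp <;> ring

/-- The linearized right alternative law. -/
theorem right_alternative (x y z : Octonion) :
    (z * x) * y + (z * y) * x = z * (x * y + y * x) := by
  apply ext_coord <;> simp <;> ring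


theorem dot_mul_left_skew {x : Octonion} (hx : dot x 1 = 0) (a b : Octonion) :
    dot (x * a) b = -dot a (x * b) := by
  rw [dot_one_right] at hx
  simp [dot, hx]; ring

theorem dot_mul_left_self (u v : Octonion) : dot (u * v) u = dot u u * dot v 1 := by
  simpa using dot_mul_mul_left u v 1

theorem dot_mul_right_self (u v : Octonion) : dot (u * v) v = dot v v * dot u 1 := by
  simpa using dot_mul_mul_right v u 1

/-- Linearized left alternativity for z and u lets z pass across u at the cost of a sign; the
anticommutation of z with v and with uv does the rest. This is the rule that fixes products
involving the second quaternionic summand. -/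
theorem mul_mul_of_anticomm {u v z : Octonion} (hu : u * z = -(z * u)) (hv : v * z = -(z * v))
    (huv : z * (u * v) = -((u * v) * z)) : u * (v * z) = -((u * v) * z) := by
  have h := left_alternative z u v
  rw [hu, add_neg_cancel, zero_mul] at h
  rw [hv, mul_neg, ← huv, eq_comm, ← add_eq_zero_iff_eq_neg, h]

theorem mul_mul_self {u v : Octonion} (hu : u * u = -1) : u * (u * v) = -v := by
  have h := left_alternative u u v
  rw [hu, ← two_smul ℝ, ← two_smul ℝ (-1 : Octonion), smul_mul_assoc, neg_mul, one_mul] at h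
  exact smul_right_injective _ two_ne_zero h

theorem mul_self_mul {u v : Octonion} (hu : u * u = -1) : (v * u) * u = -v := by
  have h := right_alternative u u v
  rw [hu, ← two_smul ℝ, ← two_smul ℝ (-1 : Octonion), mul_smul_comm, mul_neg, mul_one] at h
  exact smul_right_injective _ two_ne_zero h

theorem mul_self_of_unit {x : Octonion} (hx : dot x 1 = 0) (h : dot x x = 1) : x * x = -1 := by
  rw [mul_self_of_imag hx, h, neg_one_smul]

/-! ### Basic triples and automorphisms of the octonions -/

/-- Two orthonormal imaginary octonions together with a unit octonion orthogonal to the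
quaternion subalgebra they generate. -/
structure IsBasicTriple (x y z : Octonion) : Prop where
  x_one : dot x 1 = 0
  y_one : dot y 1 = 0
  z_one : dot z 1 = 0
  x_x : dot x x = 1
  y_y : dot y y = 1
  z_z : dot z z = 1
  x_y : dot x y = 0
  x_z : dot x z = 0
  y_z : dot y z = 0
  xy_z : dot (x * y) z = 0

/-- An automorphism of the algebra of octonions, as a property of a linear automorphism. -/
def IsAut (Φ : Octonion ≃ₗ[ℝ] Octonion) : Prop := ∀ a b, Φ (a * b) = Φ a * Φ b

theorem IsAut.symm {Φ : Octonion ≃ₗ[ℝ] Octonion} (h : IsAut Φ) : IsAut Φ.symm := fun a b => by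
  apply Φ.injective
  rw [h]
  simp

/-- The linear map sending `1, i, j, k, l, il, jl, kl` to `1, x, y, xy, z, xz, yz, (xy)z`. -/
noncomputable def tripleMap (x y z : Octonion) : Octonion →ₗ[ℝ] Octonion where
  toFun a := a.c0 • (1 : Octonion) + a.c1 • x + a.c2 • y + a.c3 • (x * y) + a.c4 • z
    + a.c5 • (x * z) + a.c6 • (y * z) + a.c7 • ((x * y) * z)
  map_add' a b := by
    simp only [c0_add, c1_add, c2_add, c3_add, c4_add, c5_add, c6_add, c7_add]
    module
  map_smul' r a := by
    simp only [c0_smul, c1_smul, c2_smul, c3_smul, c4_smul, c5_smul, c6_smul, c7_smul,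
      RingHom.id_apply]
    module

theorem tripleMap_apply (x y z a : Octonion) : tripleMap x y z a =
    a.c0 • (1 : Octonion) + a.c1 • x + a.c2 • y + a.c3 • (x * y) + a.c4 • z
    + a.c5 • (x * z) + a.c6 • (y * z) + a.c7 • ((x * y) * z) := rfl

/-- The orthogonality relations make the seven units 1-orthogonal, pairwise orthogonal and hence
anticommuting. The alternative laws then force the whole multiplication table, which is therefore
the one of i, j, k, l, il, jl, kl. -/
theorem IsBasicTriple.tripleMap_mul {x y z : Octonion} (h : IsBasicTriple x y z) (a b : Octonion) :
    tripleMap x y z (a * b) = tripleMap x y z a * tripleMap x y z b := by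
  obtain ⟨x1, y1, z1, xx, yy, zz, xy, xz, yz, wz⟩ := h
  have hx := mul_self_of_unit x1 xx
  have hy := mul_self_of_unit y1 yy
  have hz := mul_self_of_unit z1 zz
  set w := x * y with hw
  set p := x * z with hp
  set q := y * z with hq
  set r := w * z with hr
  have w1 : dot w 1 = 0 := by rw [hw, dot_mul_one _ _ x1, xy, neg_zero]
  have p1 : dot p 1 = 0 := by rw [hp, dot_mul_one _ _ x1, xz, neg_zero]
  have q1 : dot q 1 = 0 := by rw [hq, dot_mul_one _ _ y1, yz, neg_zero]
  have r1 : dot r 1 = 0 := by rw [hr, dot_mul_one _ _ w1, wz, neg_zero]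
  have hw' := mul_self_of_unit w1 (by rw [hw, dot_mul_mul_left, xx, yy, one_mul])
  have hp' := mul_self_of_unit p1 (by rw [hp, dot_mul_mul_left, xx, zz, one_mul])
  have hq' := mul_self_of_unit q1 (by rw [hq, dot_mul_mul_left, yy, zz, one_mul])
  have xw : dot x w = 0 := by rw [dot_comm, hw, dot_mul_left_self, y1, mul_zero]
  have yw : dot y w = 0 := by rw [dot_comm, hw, dot_mul_right_self, x1, mul_zero]
  have ww : dot w w = 1 := by rw [hw, dot_mul_mul_left, xx, yy, one_mul]
  have hr' := mul_self_of_unit r1 (by rw [hr, dot_mul_mul_left, ww, zz, one_mul])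
  have eyx : y * x = -w := anticomm x1 y1 xy
  have exw : x * w = -y := by rw [hw, mul_mul_self hx]
  have ewx : w * x = y := by rw [anticomm x1 w1 xw, exw, neg_neg]
  have ewy : w * y = -x := by rw [hw, mul_self_mul hy]
  have eyw : y * w = x := by rw [anticomm w1 y1 ((dot_comm _ _).trans yw), ewy, neg_neg]
  have ezx : z * x = -p := anticomm x1 z1 xz
  have ezy : z * y = -q := anticomm y1 z1 yz
  have ezw : z * w = -r := anticomm w1 z1 wz
  have xp : dot x p = 0 := by rw [dot_comm, hp, dot_mul_left_self, z1, mul_zero]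
  have zp : dot z p = 0 := by rw [dot_comm, hp, dot_mul_right_self, x1, mul_zero]
  have yp : dot y p = 0 := by
    rw [dot_comm, hp, dot_mul_left_skew x1, ← hw, dot_comm, wz, neg_zero]
  have wp : dot w p = 0 := by rw [hw, hp, dot_mul_mul_left, yz, mul_zero]
  have yq : dot y q = 0 := by rw [dot_comm, hq, dot_mul_left_self, z1, mul_zero]
  have zq : dot z q = 0 := by rw [dot_comm, hq, dot_mul_right_self, y1, mul_zero]
  have xq : dot x q = 0 := by
    rw [dot_comm, hq, dot_mul_left_skew y1, eyx, dot_neg_right, dot_comm, wz, neg_zero, neg_zero]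
  have wq : dot w q = 0 := by
    rw [← neg_neg w, ← eyx, hq, dot_neg_left, dot_mul_mul_left, xz, mul_zero, neg_zero]
  have pq : dot p q = 0 := by rw [hp, hq, dot_mul_mul_right, xy, mul_zero]
  have wr : dot w r = 0 := by rw [dot_comm, hr, dot_mul_left_self, z1, mul_zero]
  have zr : dot z r = 0 := by rw [dot_comm, hr, dot_mul_right_self, w1, mul_zero]
  have xr : dot x r = 0 := by rw [dot_comm, hr, dot_mul_left_skew w1, ewx, dot_comm, yz, neg_zero]
  have yr : dot y r = 0 := by
    rw [dot_comm, hr, dot_mul_left_skew w1, ewy, dot_neg_right, dot_comm, xz, neg_zero, neg_zero]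
  have pr : dot p r = 0 := by rw [hp, hr, dot_mul_mul_right, xw, mul_zero]
  have qr : dot q r = 0 := by rw [hq, hr, dot_mul_mul_right, yw, mul_zero]
  have assoc : ∀ u v, dot u 1 = 0 → dot v 1 = 0 → dot (u * v) 1 = 0 → dot z u = 0 → dot z v = 0 →
      dot z (u * v) = 0 → u * (v * z) = -((u * v) * z) := fun u v u1 v1 uv1 zu zv zuv =>
    mul_mul_of_anticomm (anticomm z1 u1 zu) (anticomm z1 v1 zv)
      (anticomm uv1 z1 ((dot_comm _ _).trans zuv))
  have zx := (dot_comm z x).trans xz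
  have zy := (dot_comm z y).trans yz
  have zw := (dot_comm z w).trans wz
  have exp : x * p = -z := by rw [hp, mul_mul_self hx]
  have eyq : y * q = -z := by rw [hq, mul_mul_self hy]
  have ewr : w * r = -z := by rw [hr, mul_mul_self hw']
  have exq : x * q = -r := assoc x y x1 y1 w1 zx zy zw
  have exr : x * r = q := by
    have := assoc x w x1 w1 (by rw [exw, dot_neg_left, y1, neg_zero]) zx zw
      (by rw [exw, dot_neg_right, zy, neg_zero])
    rw [hr, this, exw, neg_mul, neg_neg]
  have eyp : y * p = r := by
    have := assoc y x y1 x1 (by rw [eyx, dot_neg_left, w1, neg_zero]) zy zx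
      (by rw [eyx, dot_neg_right, zw, neg_zero])
    rw [hp, this, eyx, neg_mul, neg_neg]
  have eyr : y * r = -p := by
    have := assoc y w y1 w1 (by rw [eyw, x1]) zy zw (by rw [eyw, zx])
    rw [hr, this, eyw]
  have ewp : w * p = -q := by
    have := assoc w x w1 x1 (by rw [ewx, y1]) zw zx (by rw [ewx, zy])
    rw [hp, this, ewx]
  have ewq : w * q = p := by
    have := assoc w y w1 y1 (by rw [ewy, dot_neg_left, x1, neg_zero]) zw zy
      (by rw [ewy, dot_neg_right, zx, neg_zero])
    rw [hq, this, ewy, neg_mul, neg_neg]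
  have epx : p * x = z := by rw [anticomm x1 p1 xp, exp, neg_neg]
  have eqx : q * x = r := by rw [anticomm x1 q1 xq, exq, neg_neg]
  have erx : r * x = -q := by rw [anticomm x1 r1 xr, exr]
  have epy : p * y = -r := by rw [anticomm y1 p1 yp, eyp]
  have eqy : q * y = z := by rw [anticomm y1 q1 yq, eyq, neg_neg]
  have ery : r * y = p := by rw [anticomm y1 r1 yr, eyr, neg_neg]
  have epw : p * w = q := by rw [anticomm w1 p1 wp, ewp, neg_neg]
  have eqw : q * w = -p := by rw [anticomm w1 q1 wq, ewq]
  have erw : r * w = z := by rw [anticomm w1 r1 wr, ewr, neg_neg]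
  have epz : p * z = -x := by rw [hp, mul_self_mul hz]
  have eqz : q * z = -y := by rw [hq, mul_self_mul hz]
  have erz : r * z = -w := by rw [hr, mul_self_mul hz]
  have ezp : z * p = x := by
    rw [anticomm p1 z1 ((dot_comm _ _).trans zp), epz, neg_neg]
  have ezq : z * q = y := by
    rw [anticomm q1 z1 ((dot_comm _ _).trans zq), eqz, neg_neg]
  have ezr : z * r = w := by
    rw [anticomm r1 z1 ((dot_comm _ _).trans zr), erz, neg_neg]
  have epq : p * q = -w := by
    have := assoc p y p1 y1 (by rw [epy, dot_neg_left, r1, neg_zero]) zp zy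
      (by rw [epy, dot_neg_right, zr, neg_zero])
    rw [hq, this, epy, neg_mul, neg_neg, erz]
  have epr : p * r = y := by
    have := assoc p w p1 w1 (by rw [epw, q1]) zp zw (by rw [epw, zq])
    rw [hr, this, epw, eqz, neg_neg]
  have eqr : q * r = -x := by
    have := assoc q w q1 w1 (by rw [eqw, dot_neg_left, p1, neg_zero]) zq zw
      (by rw [eqw, dot_neg_right, zp, neg_zero])
    rw [hr, this, eqw, neg_mul, neg_neg, epz]
  have eqp : q * p = w := by rw [anticomm p1 q1 pq, epq, neg_neg]
  have erp : r * p = -y := by rw [anticomm p1 r1 pr, epr]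
  have erq : r * q = x := by rw [anticomm q1 r1 qr, eqr, neg_neg]
  have exy : x * y = w := rfl
  have exz : x * z = p := rfl
  have eyz : y * z = q := rfl
  have ewz : w * z = r := rfl
  -- From here the products are opaque atoms, so that the table can be used for rewriting without
  -- unfolding them.
  clear_value w p q r
  simp only [tripleMap_apply, exy, exz, eyz, ewz, c0_mul, c1_mul, c2_mul, c3_mul, c4_mul, c5_mul,
    c6_mul, c7_mul]
  simp only [add_mul, mul_add, smul_mul_assoc, mul_smul_comm, one_mul, mul_one, hx, hy, hz, hw',
    hp', hq', hr', exy, exz, eyz, ewz,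
    eyx, ewx, ewy, ezx, epx, eqx, erx, ezy, epy, eqy, ery, ezw, epw, eqw, erw, epz, eqz, erz, eqp, erp, erq, exw, eyw, exp, exq, exr, eyp, eyq, eyr, ewp, ewq, ewr, ezp, ezq, ezr, epq, epr, eqr]
  module

theorem IsBasicTriple.exists_isAut {x y z : Octonion} (h : IsBasicTriple x y z) :
    ∃ Φ : Octonion ≃ₗ[ℝ] Octonion, IsAut Φ ∧ Φ uI = x ∧ Φ uJ = y ∧ Φ uL = z := by
  have h1 : tripleMap x y z 1 = 1 := by simp [tripleMap_apply]
  have inj : Function.Injective (tripleMap x y z) := by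
    rw [← LinearMap.ker_eq_bot, LinearMap.ker_eq_bot']
    intro a ha
    -- The conjugate of a: since ab = |a|²·1, a multiplicative map fixing 1 and killing a gives |a|²
    -- = 0.
    let b : Octonion := Octonion.mk a.c0 (-a.c1) (-a.c2) (-a.c3) (-a.c4) (-a.c5) (-a.c6) (-a.c7)
    have hab : a * b = dot a a • (1 : Octonion) := by
      apply ext_coord <;> simp [dot, b] <;> ring
    have := h.tripleMap_mul a b
    rw [ha, zero_mul, hab, map_smul, h1] at this
    have h0 := congrArg c0 this
    exact eq_zero_of_dot_self (by simpa using h0)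
  refine ⟨LinearEquiv.ofInjectiveEndo _ inj, fun a b => h.tripleMap_mul a b, ?_, ?_, ?_⟩ <;>
    simp [tripleMap_apply, uI, uJ, uL]


/-! ### Derivations are skew and determined on i, j, l -/

section derivation

variable (D : CompactG2)

theorem der_mul (x y : Octonion) : D.1 (x * y) = D.1 x * y + x * D.1 y := D.2 x y

theorem der_one : D.1 1 = 0 := by
  have := der_mul D 1 1
  rw [mul_one, mul_one, one_mul] at this
  exact left_eq_add.1 this

theorem lie_val_apply (A B : CompactG2) (x : Octonion) :
    (⁅A, B⁆ : CompactG2).1 x = A.1 (B.1 x) - B.1 (A.1 x) := rfl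

/-- Differentiating x² = -|x|²·1 gives (Dx)x + x(Dx) = 0. Its real part is the orthogonality of Dx
and x, and its imaginary part is 2 Re(Dx) x. -/
theorem der_of_imag {x : Octonion} (hx : dot x 1 = 0) :
    dot (D.1 x) 1 = 0 ∧ dot (D.1 x) x = 0 := by
  have h := der_mul D x x
  rw [mul_self_of_imag hx, map_smul, der_one, smul_zero, eq_comm] at h
  rw [dot_one_right] at hx
  have h0 := congrArg c0 h
  have h1 := congrArg c1 h
  have h2 := congrArg c2 h
  have h3 := congrArg c3 h
  have h4 := congrArg c4 h
  have h5 := congrArg c5 h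
  have h6 := congrArg c6 h
  have h7 := congrArg c7 h
  simp only [c0_add, c0_mul, c0_zero, c1_add, c1_mul, c1_zero, c2_add, c2_mul, c2_zero,
    c3_add, c3_mul, c3_zero, c4_add, c4_mul, c4_zero, c5_add, c5_mul, c5_zero,
    c6_add, c6_mul, c6_zero, c7_add, c7_mul, c7_zero, hx] at h0 h1 h2 h3 h4 h5 h6 h7
  have hc : (D.1 x).c0 • x = 0 := by
    apply ext_coord <;> simp only [c0_smul, c1_smul, c2_smul, c3_smul, c4_smul, c5_smul, c6_smul,
      c7_smul, c0_zero, c1_zero, c2_zero, c3_zero, c4_zero, c5_zero, c6_zero, c7_zero, hx] <;>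
      linarith
  refine ⟨?_, by simp only [dot, hx]; linarith⟩
  rw [dot_one_right]
  rcases smul_eq_zero.1 hc with h | rfl
  · exact h
  · simp

theorem der_dot_one (x : Octonion) : dot (D.1 x) 1 = 0 := by
  have h : dot (x - x.c0 • (1 : Octonion)) 1 = 0 := by rw [dot_one_right]; simp
  have := (der_of_imag D h).1
  rwa [map_sub, map_smul, der_one, smul_zero, sub_zero] at this

theorem der_dot_self (x : Octonion) : dot (D.1 x) x = 0 := by
  have h : dot (x - x.c0 • (1 : Octonion)) 1 = 0 := by rw [dot_one_right]; simp
  have := (der_of_imag D h).2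
  rwa [map_sub, map_smul, der_one, smul_zero, sub_zero, dot_sub_right, dot_smul_right,
    der_dot_one, mul_zero, sub_zero] at this

/-- Derivations of the octonions are skew-symmetric. -/
theorem der_skew (x y : Octonion) : dot (D.1 x) y = -dot x (D.1 y) := by
  have := der_dot_self D (x + y)
  rw [map_add, dot_add_left, dot_add_right, dot_add_right, der_dot_self, der_dot_self,
    dot_comm (D.1 y)] at this
  linarith

theorem der_uK : D.1 uK = D.1 uI * uJ + uI * D.1 uJ := by rw [← uI_mul_uJ, der_mul]
theorem der_uIL : D.1 uIL = D.1 uI * uL + uI * D.1 uL := by rw [← uI_mul_uL, der_mul]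
theorem der_uJL : D.1 uJL = D.1 uJ * uL + uJ * D.1 uL := by rw [← uJ_mul_uL, der_mul]
theorem der_uKL : D.1 uKL = D.1 uK * uL + uK * D.1 uL := by rw [← uK_mul_uL, der_mul]

theorem der_apply (x : Octonion) : D.1 x = x.c1 • D.1 uI + x.c2 • D.1 uJ
    + x.c3 • D.1 uK + x.c4 • D.1 uL + x.c5 • D.1 uIL + x.c6 • D.1 uJL + x.c7 • D.1 uKL := by
  conv_lhs => rw [eq_sum x]
  simp only [map_add, map_smul, der_one, smul_zero, zero_add]

variable {D}

/-- A derivation of the octonions is determined by its values at `i`, `j` and `l`. -/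
theorem der_ext {D' : CompactG2} (hI : D.1 uI = D'.1 uI) (hJ : D.1 uJ = D'.1 uJ)
    (hL : D.1 uL = D'.1 uL) : D = D' := by
  have hK : D.1 uK = D'.1 uK := by rw [der_uK, der_uK, hI, hJ]
  apply Subtype.ext
  apply LinearMap.ext
  intro x
  rw [der_apply D x, der_apply D' x, der_uIL, der_uIL, der_uJL, der_uJL, der_uKL, der_uKL, hK, hI, hJ, hL]

end derivation

/-- Conjugation of derivations by an automorphism of the octonions. -/
noncomputable def conjEquiv {Φ : Octonion ≃ₗ[ℝ] Octonion} (h : IsAut Φ) :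
    CompactG2 ≃ₗ⁅ℝ⁆ CompactG2 where
  toFun D := ⟨Φ.toLinearMap ∘ₗ D.1 ∘ₗ Φ.symm.toLinearMap, fun x y => by
    simp [h.symm x y, der_mul, h (D.1 (Φ.symm x)), h (Φ.symm x)]⟩
  invFun D := ⟨Φ.symm.toLinearMap ∘ₗ D.1 ∘ₗ Φ.toLinearMap, fun x y => by
    simp [h x y, der_mul, h.symm (D.1 (Φ x)), h.symm (Φ x)]⟩
  map_add' A B := by
    apply Subtype.ext; apply LinearMap.ext; intro x
    exact map_add Φ _ _
  map_smul' r A := by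
    apply Subtype.ext; apply LinearMap.ext; intro x
    exact map_smul Φ _ _
  map_lie' := by
    intro A B
    apply Subtype.ext; apply LinearMap.ext; intro x
    change Φ (A.1 (B.1 (Φ.symm x)) - B.1 (A.1 (Φ.symm x))) =
      Φ (A.1 (Φ.symm (Φ (B.1 (Φ.symm x))))) - Φ (B.1 (Φ.symm (Φ (A.1 (Φ.symm x)))))
    simp
  left_inv A := by
    apply Subtype.ext; apply LinearMap.ext; intro x
    change Φ.symm (Φ (A.1 (Φ.symm (Φ x)))) = A.1 x
    simp
  right_inv A := by
    apply Subtype.ext; apply LinearMap.ext; intro x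
    change Φ (Φ.symm (A.1 (Φ (Φ.symm x)))) = A.1 x
    simp

theorem conjEquiv_symm_apply {Φ : Octonion ≃ₗ[ℝ] Octonion} (h : IsAut Φ) (D : CompactG2)
    (x : Octonion) : ((conjEquiv h).symm D).1 x = Φ.symm (D.1 (Φ x)) := rfl

/-- The derivation `a + bl ↦ [p, a] + (qb - bp)l`, for imaginary quaternions `p` and `q`. -/
noncomputable def quatDer (p1 p2 p3 q1 q2 q3 : ℝ) : CompactG2 where
  val :=
    { toFun := fun x => mk 0 (2 * (p2 * x.c3 - p3 * x.c2)) (2 * (p3 * x.c1 - p1 * x.c3))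
        (2 * (p1 * x.c2 - p2 * x.c1))
        (-((q1 - p1) * x.c5) - (q2 - p2) * x.c6 - (q3 - p3) * x.c7)
        ((q1 - p1) * x.c4 + (q2 + p2) * x.c7 - (q3 + p3) * x.c6)
        ((q2 - p2) * x.c4 + (q3 + p3) * x.c5 - (q1 + p1) * x.c7)
        ((q3 - p3) * x.c4 + (q1 + p1) * x.c6 - (q2 + p2) * x.c5)
      map_add' := fun x y => by apply ext_coord <;> simp <;> ring
      map_smul' := fun r x => by apply ext_coord <;> simp <;> ring }
  property := fun x y => by
    apply ext_coord <;> simp <;> ring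

theorem quatDer_apply (p1 p2 p3 q1 q2 q3 : ℝ) (x : Octonion) :
    (quatDer p1 p2 p3 q1 q2 q3).1 x =
      mk 0 (2 * (p2 * x.c3 - p3 * x.c2)) (2 * (p3 * x.c1 - p1 * x.c3))
        (2 * (p1 * x.c2 - p2 * x.c1))
        (-((q1 - p1) * x.c5) - (q2 - p2) * x.c6 - (q3 - p3) * x.c7)
        ((q1 - p1) * x.c4 + (q2 + p2) * x.c7 - (q3 + p3) * x.c6)
        ((q2 - p2) * x.c4 + (q3 + p3) * x.c5 - (q1 + p1) * x.c7)
        ((q3 - p3) * x.c4 + (q1 + p1) * x.c6 - (q2 + p2) * x.c5) := rfl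

/-- The derivation with `i ↦ sj`, `j ↦ -si + tl` and `l ↦ -tj - (s/2)kl`. -/
noncomputable def mixedDer (s t : ℝ) : CompactG2 where
  val :=
    { toFun := fun x => mk 0 (-(s * x.c2)) (s * x.c1 - t * x.c4) (-(t * x.c5))
        (t * x.c2 + s / 2 * x.c7) (t * x.c3 - s / 2 * x.c6) (s / 2 * x.c5) (-(s / 2 * x.c4))
      map_add' := fun x y => by apply ext_coord <;> simp <;> ring
      map_smul' := fun r x => by apply ext_coord <;> simp <;> ring }
  property := fun x y => by
    apply ext_coord <;> simp <;> ring

theorem mixedDer_apply (s t : ℝ) (x : Octonion) :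
    (mixedDer s t).1 x = mk 0 (-(s * x.c2)) (s * x.c1 - t * x.c4) (-(t * x.c5))
        (t * x.c2 + s / 2 * x.c7) (t * x.c3 - s / 2 * x.c6) (s / 2 * x.c5) (-(s / 2 * x.c4)) := rfl

end Octonion

/-! ### Operators with [h, e] = 2e -/

section linearAlgebra

open Module Module.End

variable {K V : Type*} [Field K] [AddCommGroup V] [Module K V]

theorem mul_pow_of_lie_eq_two_nsmul {h e : End K V} (he : h * e - e * h = (2 : K) • e) (n : ℕ) :
    h * e ^ n - e ^ n * h = (2 * n : K) • e ^ n := by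
  induction n with
  | zero => simp
  | succ n ih =>
    have : h * e ^ (n + 1) - e ^ (n + 1) * h
        = (h * e ^ n - e ^ n * h) * e + e ^ n * (h * e - e * h) := by
      rw [pow_succ]; noncomm_ring
    rw [this, ih, he, smul_mul_assoc, mul_smul_comm, ← pow_succ, ← add_smul]
    congr 1; push_cast; ring

theorem apply_pow_of_lie_eq_two_nsmul {h e : End K V} (he : h * e - e * h = (2 : K) • e) (n : ℕ)
    {v : V} (hv : h v = 0) : h ((e ^ n) v) = (2 * n : K) • (e ^ n) v := by
  have := LinearMap.congr_fun (mul_pow_of_lie_eq_two_nsmul he n) v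
  simpa [hv] using this

variable [CharZero K] [Module.Finite K V]

/-- Each nonzero power eⁿ is an eigenvector of the commutator with h for the eigenvalue 2n. In
characteristic zero these are distinct, and a finite-dimensional space allows only finitely many. -/
theorem isNilpotent_of_lie_eq_two_nsmul {h e : End K V} (he : h * e - e * h = (2 : K) • e) :
    IsNilpotent e := by
  by_contra hn
  have hn' : ∀ n, e ^ n ≠ 0 := fun n h0 => hn ⟨n, h0⟩
  let A : End K (End K V) := LinearMap.mulLeft K h - LinearMap.mulRight K h
  have hA : ∀ n : ℕ, A.HasEigenvalue (2 * n : K) := fun n =>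
    hasEigenvalue_of_hasEigenvector (x := e ^ n)
      ⟨mem_eigenspace_iff.2 (mul_pow_of_lie_eq_two_nsmul he n), hn' n⟩
  refine Set.infinite_of_injective_forall_mem (f := fun n : ℕ => (2 * n : K)) ?_ hA
    A.finite_hasEigenvalue
  intro m n hmn
  simpa using hmn

/-- If `[h, e] = 2e` with `e` nilpotent, then the kernel of `e` is at least as large as that
of `h`. -/
theorem finrank_ker_le_of_lie_eq_two_nsmul {h e : End K V} (he : h * e - e * h = (2 : K) • e) :
    finrank K (LinearMap.ker h) ≤ finrank K (LinearMap.ker e) := by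
  -- Filter ker h by the kernels of the powers of e. On the layer ker h ∩ ker eⁿ⁺¹ the map eⁿ has
  -- kernel the previous layer and lands in the part of ker e where h acts by 2n. These targets are
  -- independent for different n, so the dimensions add up inside ker e.
  have key : ∀ n : ℕ, finrank K ↥(LinearMap.ker h ⊓ LinearMap.ker (e ^ n)) ≤
      finrank K ↥(LinearMap.ker e ⊓ ⨆ k ∈ Finset.range n, eigenspace h (2 * k : K)) := by
    intro n
    induction n with
    | zero =>
      have : LinearMap.ker h ⊓ LinearMap.ker (e ^ 0) = ⊥ := by
        rw [pow_zero, Module.End.one_eq_id, LinearMap.ker_id, inf_bot_eq]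
      rw [this, finrank_bot]
      exact Nat.zero_le _
    | succ n ih =>
      let A := LinearMap.ker h ⊓ LinearMap.ker (e ^ (n + 1))
      let f : A →ₗ[K] V := (e ^ n).domRestrict A
      have hr := f.finrank_range_add_finrank_ker
      have h1 : finrank K (LinearMap.ker f) ≤ finrank K ↥(LinearMap.ker h ⊓ LinearMap.ker (e ^ n)) := by
        rw [← LinearMap.finrank_range_of_inj (f := A.subtype ∘ₗ (LinearMap.ker f).subtype)
          (A.subtype_injective.comp (LinearMap.ker f).subtype_injective)]
        apply Submodule.finrank_mono
        rintro _ ⟨⟨⟨v, hv⟩, hv'⟩, rfl⟩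
        exact ⟨hv.1, hv'⟩
      have h2 : LinearMap.range f ≤ LinearMap.ker e ⊓ eigenspace h (2 * n : K) := by
        rintro _ ⟨⟨v, hv⟩, rfl⟩
        refine ⟨?_, mem_eigenspace_iff.2 (apply_pow_of_lie_eq_two_nsmul he n hv.1)⟩
        have : (e ^ (n + 1)) v = 0 := hv.2
        rwa [pow_succ'] at this
      have h3 := Submodule.finrank_mono h2
      have hd : Disjoint (LinearMap.ker e ⊓ eigenspace h (2 * n : K))
          (LinearMap.ker e ⊓ ⨆ k ∈ Finset.range n, eigenspace h (2 * k : K)) := by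
        refine Disjoint.mono inf_le_right inf_le_right ?_
        have hi : iSupIndep fun k : ℕ => eigenspace h (2 * k : K) :=
          (eigenspaces_iSupIndep h).comp fun a b hab => by simpa using hab
        refine (hi n).mono_right ?_
        refine iSup₂_le fun k hk => ?_
        exact le_iSup₂_of_le k (by rintro rfl; simp at hk) le_rfl
      have h4 := Submodule.finrank_sup_add_finrank_inf_eq (LinearMap.ker e ⊓ eigenspace h (2 * n : K))
        (LinearMap.ker e ⊓ ⨆ k ∈ Finset.range n, eigenspace h (2 * k : K))
      rw [hd.eq_bot, finrank_bot, add_zero] at h4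
      have h5 : (LinearMap.ker e ⊓ eigenspace h (2 * n : K)) ⊔
          (LinearMap.ker e ⊓ ⨆ k ∈ Finset.range n, eigenspace h (2 * k : K)) ≤
          LinearMap.ker e ⊓ ⨆ k ∈ Finset.range (n + 1), eigenspace h (2 * k : K) := by
        refine sup_le (inf_le_inf_left _ ?_) (inf_le_inf_left _ ?_)
        · exact le_iSup₂_of_le n (by simp) le_rfl
        · refine iSup₂_le fun k hk => le_iSup₂_of_le k ?_ le_rfl
          simp only [Finset.mem_range] at hk ⊢
          omega
      have h6 := Submodule.finrank_mono h5
      change finrank K A ≤ _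
      omega
  obtain ⟨n, hn⟩ := isNilpotent_of_lie_eq_two_nsmul he
  have := key n
  rw [hn, LinearMap.ker_zero, inf_top_eq] at this
  exact this.trans (Submodule.finrank_mono inf_le_left)

end linearAlgebra

/-! ### Rank under extension of scalars -/

theorem natTrailingDegree_map_of_injective {S T : Type*} [CommRing S] [CommRing T] {f : S →+* T}
    (hf : Function.Injective f) (p : Polynomial S) :
    (p.map f).natTrailingDegree = p.natTrailingDegree := by
  by_cases hp : p = 0
  · simp [hp]
  have hp' : p.map f ≠ 0 := (Polynomial.map_ne_zero_iff hf).2 hp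
  apply le_antisymm
  · apply Polynomial.natTrailingDegree_le_of_ne_zero
    rw [Polynomial.coeff_map]
    exact (map_ne_zero_iff f hf).2 (Polynomial.trailingCoeff_nonzero_iff_nonzero.2 hp)
  · apply Polynomial.natTrailingDegree_le_of_ne_zero
    intro h0
    refine Polynomial.trailingCoeff_nonzero_iff_nonzero.2 hp' ?_
    rw [Polynomial.trailingCoeff, Polynomial.coeff_map, h0, map_zero]

section rank

variable {R A L : Type*} [Field R] [Field A] [Algebra R A] [LieRing L] [LieAlgebra R L]
  [Module.Finite R L]

/-- The rank is the trailing degree of the generic characteristic polynomial of ad. That polynomial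
is compatible with base change, and an injective map of coefficients preserves trailing degrees. -/
theorem LieAlgebra.rank_baseChange : LieAlgebra.rank A (A ⊗[R] L) = LieAlgebra.rank R L := by
  classical
  let b := Module.finBasis R L
  have had : (LieAlgebra.ad A (A ⊗[R] L)).toLinearMap =
      LinearMap.tensorProduct R A L L ∘ₗ (LieAlgebra.ad R L).toLinearMap.baseChange A := by
    ext x y
    simp [LinearMap.tensorProduct]
  have hp := LinearMap.polyCharpoly_baseChange (LieAlgebra.ad R L).toLinearMap b A
  rw [← had] at hp
  rw [LieAlgebra.rank_eq_natTrailingDegree A (A ⊗[R] L) (Algebra.TensorProduct.basis A b),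
    LieAlgebra.rank_eq_natTrailingDegree R L b, hp]
  exact natTrailingDegree_map_of_injective
    (MvPolynomial.map_injective _ (algebraMap R A).injective) _

end rank

/-! ### Eigenvectors, and conjugation of derivations into a torus -/

namespace Octonion

/-- The spectral theorem on U, with `dot` as inner product. -/
theorem exists_unit_eigenvector {U : Submodule ℝ Octonion} (hU : U ≠ ⊥)
    (T : Octonion →ₗ[ℝ] Octonion) (hT : ∀ x ∈ U, T x ∈ U)
    (hs : ∀ x ∈ U, ∀ y ∈ U, dot (T x) y = dot x (T y)) :
    ∃ u ∈ U, dot u u = 1 ∧ ∃ a : ℝ, T u = a • u := by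
  let core : InnerProductSpace.Core ℝ U :=
    { inner := fun x y => dot x y
      conj_inner_symm := fun x y => dot_comm _ _
      re_inner_nonneg := fun x => dot_self_nonneg _
      add_left := fun x y z => dot_add_left _ _ _
      smul_left := fun x y r => dot_smul_left _ _ _
      definite := fun x h => Subtype.ext (eq_zero_of_dot_self h) }
  let _ := core.toNormedAddCommGroup
  let _ := InnerProductSpace.ofCore core.toCore
  have : Nontrivial U := Submodule.nontrivial_iff_ne_bot.2 hU
  have hsym : (T.restrict hT).IsSymmetric := fun x y => hs x x.2 y y.2
  obtain ⟨a, u, hu⟩ : ∃ a, ∃ u, Module.End.HasEigenvector (T.restrict hT) a u :=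
    ⟨_, hsym.hasEigenvalue_iSup_of_finiteDimensional.exists_hasEigenvector⟩
  have hu0 : (u : Octonion) ≠ 0 := fun h => hu.2 (Subtype.ext h)
  have hpos := dot_self_pos hu0
  refine ⟨(√(dot (u : Octonion) u))⁻¹ • (u : Octonion), U.smul_mem _ u.2, ?_, a, ?_⟩
  · rw [dot_smul_left, dot_smul_right, ← mul_assoc, ← mul_inv, Real.mul_self_sqrt hpos.le,
      inv_mul_cancel₀ hpos.ne']
  · rw [map_smul, smul_comm]
    congr 1
    exact congrArg Subtype.val hu.apply_eq_smul

/-- The orthogonal complement of four octonions. -/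
def perp (a b c d : Octonion) : Submodule ℝ Octonion where
  carrier := {x | dot x a = 0 ∧ dot x b = 0 ∧ dot x c = 0 ∧ dot x d = 0}
  add_mem' := by
    rintro x y ⟨h1, h2, h3, h4⟩ ⟨h1', h2', h3', h4'⟩
    simp only [Set.mem_ofPred_eq, dot_add_left, *, add_zero, and_self]
  zero_mem' := by simp
  smul_mem' := by
    rintro r x ⟨h1, h2, h3, h4⟩
    simp only [Set.mem_ofPred_eq, dot_smul_left, *, mul_zero, and_self]

theorem finrank_octonion : Module.finrank ℝ Octonion = 8 := by
  change Module.finrank ℝ (ℍ[ℝ] × ℍ[ℝ]) = 8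
  rw [Module.finrank_prod, Quaternion.finrank_eq_four]

theorem perp_ne_bot (a b c d : Octonion) : perp a b c d ≠ ⊥ := by
  let f : Octonion →ₗ[ℝ] (Fin 4 → ℝ) :=
    { toFun := fun x => ![dot x a, dot x b, dot x c, dot x d]
      map_add' := fun x y => by
        ext i; fin_cases i <;> simp [dot_add_left]
      map_smul' := fun r x => by
        ext i; fin_cases i <;> simp [dot_smul_left] }
  have h : LinearMap.ker f ≠ ⊥ := LinearMap.ker_ne_bot_of_finrank_lt (by
    rw [finrank_octonion]; simp)
  rw [Submodule.ne_bot_iff] at h ⊢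
  obtain ⟨x, hx, hx0⟩ := h
  refine ⟨x, ?_, hx0⟩
  have hf : f x = 0 := hx
  exact ⟨congrFun hf 0, congrFun hf 1, congrFun hf 2, congrFun hf 3⟩

theorem exists_unit_mem_perp (a b c d : Octonion) : ∃ u ∈ perp a b c d, dot u u = 1 := by
  obtain ⟨u, hu, h1, -⟩ := exists_unit_eigenvector (perp_ne_bot a b c d) 0
    (fun x _ => zero_mem _) (fun x _ y _ => by simp)
  exact ⟨u, hu, h1⟩

theorem exists_basicTriple {x y : Octonion} (x1 : dot x 1 = 0) (y1 : dot y 1 = 0)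
    (xx : dot x x = 1) (yy : dot y y = 1) (xy : dot x y = 0) : ∃ z, IsBasicTriple x y z := by
  obtain ⟨z, ⟨h1, h2, h3, h4⟩, hz⟩ := exists_unit_mem_perp 1 x y (x * y)
  exact ⟨z, x1, y1, h1, xx, yy, hz, xy, by rw [dot_comm, h2], by rw [dot_comm, h3],
    by rw [dot_comm, h4]⟩

/-- On the imaginary octonions D has a skew 7 × 7 matrix, and a skew matrix of odd size is singular.
-/
theorem exists_unit_der_eq_zero (D : CompactG2) : ∃ v, dot v 1 = 0 ∧ dot v v = 1 ∧ D.1 v = 0 := by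
  let e : Fin 7 → Octonion := ![uI, uJ, uK, uL, uIL, uJL, uKL]
  let M : Matrix (Fin 7) (Fin 7) ℝ := Matrix.of fun a b => dot (e a) (D.1 (e b))
  have hM : M.transpose = -M := by
    ext a b
    change dot (e b) (D.1 (e a)) = -dot (e a) (D.1 (e b))
    rw [dot_comm, der_skew]
  have hdet : M.det = 0 := by
    have := M.det_transpose
    rw [hM, Matrix.det_neg, Fintype.card_fin] at this
    linarith
  obtain ⟨v, hv0, hv⟩ := Matrix.exists_mulVec_eq_zero_iff.2 hdet
  let x := ∑ b, v b • e b
  have hx : x = mk 0 (v 0) (v 1) (v 2) (v 3) (v 4) (v 5) (v 6) := by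
    simp only [x, e, Fin.sum_univ_seven]
    apply ext_coord <;> simp [uI, uJ, uK, uL, uIL, uJL, uKL]
  have hx0 : x ≠ 0 := by
    intro h
    rw [hx] at h
    apply hv0
    ext b
    fin_cases b
    · exact congrArg c1 h
    · exact congrArg c2 h
    · exact congrArg c3 h
    · exact congrArg c4 h
    · exact congrArg c5 h
    · exact congrArg c6 h
    · exact congrArg c7 h
  have hDx : ∀ a, dot (e a) (D.1 x) = 0 := by
    intro a
    have := congrFun hv a
    simp only [Matrix.mulVec, dotProduct, M, Matrix.of_apply, Pi.zero_apply] at this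
    rw [← this]
    simp only [x, map_add, map_smul, Fin.sum_univ_seven, dot_add_right, dot_smul_right]
    ring
  have hD0 : D.1 x = 0 := by
    apply ext_coord
    · rw [← dot_one_right, der_dot_one]; rfl
    · simpa [e, dot, uI] using hDx 0
    · simpa [e, dot, uJ] using hDx 1
    · simpa [e, dot, uK] using hDx 2
    · simpa [e, dot, uL] using hDx 3
    · simpa [e, dot, uIL] using hDx 4
    · simpa [e, dot, uJL] using hDx 5
    · simpa [e, dot, uKL] using hDx 6
  have hpos := dot_self_pos hx0
  refine ⟨(√(dot x x))⁻¹ • x, ?_, ?_, ?_⟩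
  · rw [dot_smul_left, dot_one_right, hx]; simp
  · rw [dot_smul_left, dot_smul_right, ← mul_assoc, ← mul_inv, Real.mul_self_sqrt hpos.le,
      inv_mul_cancel₀ hpos.ne']
  · rw [map_smul, hD0, smul_zero]

/-- The derivation with `i ↦ 0`, `j ↦ ak` and `l ↦ b(il)`. -/
noncomputable def torusDer (a b : ℝ) : CompactG2 := quatDer (a / 2) 0 0 (b + a / 2) 0 0

theorem torusDer_apply (a b : ℝ) (x : Octonion) : (torusDer a b).1 x =
    mk 0 0 (-(a * x.c3)) (a * x.c2) (-(b * x.c5)) (b * x.c4) (-((a + b) * x.c7))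
      ((a + b) * x.c6) := by
  rw [torusDer, quatDer_apply]
  apply ext_coord <;> simp only [c0_mk, c1_mk, c2_mk, c3_mk, c4_mk, c5_mk, c6_mk, c7_mk] <;> ring

theorem conjEquiv_symm_apply_eq {Φ : Octonion ≃ₗ[ℝ] Octonion} (h : IsAut Φ) {D : CompactG2}
    {x y : Octonion} (hxy : D.1 (Φ x) = Φ y) : ((conjEquiv h).symm D).1 x = y := by
  rw [conjEquiv_symm_apply, hxy, Φ.symm_apply_apply]

/-- Left multiplication by v and D are skew and commute because Dv = 0, so x ↦ v(Dx) is symmetric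
and has an eigenvector in any nonzero invariant subspace. Multiplying by v, with v² = -1, recovers
Du. -/
theorem exists_unit_der_eq_smul_mul {D : CompactG2} {v : Octonion} (v1 : dot v 1 = 0)
    (vv : dot v v = 1) (hv : D.1 v = 0) {U : Submodule ℝ Octonion} (hU : U ≠ ⊥)
    (hT : ∀ x ∈ U, v * D.1 x ∈ U) :
    ∃ u ∈ U, dot u u = 1 ∧ ∃ a : ℝ, D.1 u = a • (v * u) := by
  have hvv := mul_self_of_unit v1 vv
  obtain ⟨u, hu, huu, a, ha⟩ := exists_unit_eigenvector hU (LinearMap.mulLeft ℝ v ∘ₗ D.1) hT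
    (fun x _ y _ => by
      simp only [LinearMap.comp_apply, LinearMap.mulLeft_apply]
      rw [dot_mul_left_skew v1, der_skew, der_mul, hv, zero_mul, zero_add, neg_neg])
  refine ⟨u, hu, huu, -a, ?_⟩
  have ha' : v * D.1 u = a • u := ha
  rw [neg_smul, ← mul_smul_comm, ← ha', mul_mul_self hvv, neg_neg]

/-- Every derivation of the octonions lies in a conjugate of the standard torus. -/
theorem exists_conj_eq_torusDer {D : CompactG2} {v : Octonion} (v1 : dot v 1 = 0)
    (vv : dot v v = 1) (hv : D.1 v = 0) : ∃ (Φ : Octonion ≃ₗ[ℝ] Octonion) (h : IsAut Φ) (a b : ℝ),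
      Φ uI = v ∧ (conjEquiv h).symm D = torusDer a b := by
  have hvv := mul_self_of_unit v1 vv
  -- The zeros are fillers: only orthogonality to 1 and v is imposed. The second eigenvector z is
  -- then sought orthogonal to the quaternions spanned by 1, v, y, vy, so that v, y, z is a basic
  -- triple.
  obtain ⟨y, hy, yy, a, ha⟩ := exists_unit_der_eq_smul_mul v1 vv hv (perp_ne_bot 1 v 0 0)
    (fun x hx => by
      refine ⟨?_, ?_, dot_zero_right _, dot_zero_right _⟩
      · rw [dot_mul_one _ _ v1, dot_comm, der_skew, hv, dot_zero_right, neg_zero, neg_zero]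
      · rw [dot_mul_left_self, der_dot_one, mul_zero])
  obtain ⟨y1, yv, -, -⟩ := hy
  obtain ⟨z, hz, zz, b, hb⟩ := exists_unit_der_eq_smul_mul v1 vv hv (perp_ne_bot 1 v y (v * y))
    (fun x hx => by
      obtain ⟨x1, xv, xy, xvy⟩ := hx
      refine ⟨?_, ?_, ?_, ?_⟩
      · rw [dot_mul_one _ _ v1, dot_comm, der_skew, hv, dot_zero_right, neg_zero, neg_zero]
      · rw [dot_mul_left_self, der_dot_one, mul_zero]
      · rw [dot_mul_left_skew v1, der_skew, der_mul, hv, zero_mul, zero_add, ha, mul_smul_comm,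
          mul_mul_self hvv, dot_smul_right, dot_neg_right, xy]
        simp
      · rw [dot_mul_mul_left, der_skew, ha, dot_smul_right, xvy]
        simp)
  obtain ⟨z1, zv, zy, zvy⟩ := hz
  have tri : IsBasicTriple v y z := ⟨v1, y1, z1, vv, yy, zz, by rw [dot_comm, yv],
    by rw [dot_comm, zv], by rw [dot_comm, zy], by rw [dot_comm, zvy]⟩
  obtain ⟨Φ, hΦ, hI, hJ, hL⟩ := tri.exists_isAut
  refine ⟨Φ, hΦ, a, b, hI, ?_⟩
  apply der_ext <;> apply conjEquiv_symm_apply_eq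
  · rw [hI, hv, torusDer_apply, eq_comm, ← map_zero Φ]
    congr 1
    apply ext_coord <;> simp [uI]
  · have : (torusDer a b).1 uJ = a • (uI * uJ) := by
      rw [torusDer_apply]
      apply ext_coord <;> simp [uI, uJ]
    rw [this, map_smul, hΦ, hI, hJ, ha]
  · have : (torusDer a b).1 uL = b • (uI * uL) := by
      rw [torusDer_apply]
      apply ext_coord <;> simp [uI, uL]
    rw [this, map_smul, hΦ, hI, hL, hb]


/-! ### The two commuting copies of 𝔰𝔬(3), and small centralizers -/

theorem quatDer_lie (p1 p2 p3 q1 q2 q3 p1' p2' p3' q1' q2' q3' : ℝ) :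
    ⁅quatDer p1 p2 p3 q1 q2 q3, quatDer p1' p2' p3' q1' q2' q3'⁆ =
      quatDer (2 * (p2 * p3' - p3 * p2')) (2 * (p3 * p1' - p1 * p3')) (2 * (p1 * p2' - p2 * p1'))
        (2 * (q2 * q3' - q3 * q2')) (2 * (q3 * q1' - q1 * q3')) (2 * (q1 * q2' - q2 * q1')) := by
  apply Subtype.ext
  apply LinearMap.ext
  intro x
  rw [lie_val_apply]
  simp only [quatDer_apply]
  apply ext_coord <;> simp <;> ring

theorem quatDer_inj {p1 p2 p3 q1 q2 q3 p1' p2' p3' q1' q2' q3' : ℝ}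
    (h : quatDer p1 p2 p3 q1 q2 q3 = quatDer p1' p2' p3' q1' q2' q3') :
    p1 = p1' ∧ p2 = p2' ∧ p3 = p3' ∧ q1 = q1' ∧ q2 = q2' ∧ q3 = q3' := by
  have h1 := congrArg (fun D : CompactG2 => (D.1 uJ).c3) h
  have h2 := congrArg (fun D : CompactG2 => (D.1 uI).c3) h
  have h3 := congrArg (fun D : CompactG2 => (D.1 uI).c2) h
  have h4 := congrArg (fun D : CompactG2 => (D.1 uL).c5) h
  have h5 := congrArg (fun D : CompactG2 => (D.1 uL).c6) h
  have h6 := congrArg (fun D : CompactG2 => (D.1 uL).c7) h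
  simp [quatDer_apply, uI, uJ, uL] at h1 h2 h3 h4 h5 h6
  subst h1 h2 h3
  simp at h4 h5 h6
  simp [h4, h5, h6]

theorem quatDer_zero : quatDer 0 0 0 0 0 0 = 0 := by
  apply Subtype.ext
  apply LinearMap.ext
  intro x
  rw [quatDer_apply]
  apply ext_coord <;> simp

theorem linearIndependent_quatDer_left :
    LinearIndependent ℝ ![quatDer 1 0 0 0 0 0, quatDer 0 1 0 0 0 0, quatDer 0 0 1 0 0 0] := by
  rw [Fintype.linearIndependent_iff]
  intro g hg
  rw [Fin.sum_univ_three] at hg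
  have h : ∀ x : Octonion, g 0 • (quatDer 1 0 0 0 0 0).1 x + g 1 • (quatDer 0 1 0 0 0 0).1 x
      + g 2 • (quatDer 0 0 1 0 0 0).1 x = 0 := fun x =>
    congrArg (fun D : CompactG2 => D.1 x) hg
  have h1 := congrArg c3 (h uJ)
  have h2 := congrArg c3 (h uI)
  have h3 := congrArg c2 (h uI)
  simp [quatDer_apply, uI, uJ] at h1 h2 h3
  intro i
  fin_cases i
  · exact h1
  · exact h2
  · exact h3

theorem linearIndependent_quatDer_right :
    LinearIndependent ℝ ![quatDer 0 0 0 1 0 0, quatDer 0 0 0 0 1 0, quatDer 0 0 0 0 0 1] := by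
  rw [Fintype.linearIndependent_iff]
  intro g hg
  rw [Fin.sum_univ_three] at hg
  have h : ∀ x : Octonion, g 0 • (quatDer 0 0 0 1 0 0).1 x + g 1 • (quatDer 0 0 0 0 1 0).1 x
      + g 2 • (quatDer 0 0 0 0 0 1).1 x = 0 := fun x =>
    congrArg (fun D : CompactG2 => D.1 x) hg
  have h1 := congrArg c5 (h uL)
  have h2 := congrArg c6 (h uL)
  have h3 := congrArg c7 (h uL)
  simp [quatDer_apply, uL] at h1 h2 h3
  intro i
  fin_cases i
  · exact h1
  · exact h2
  · exact h3

/-- The centralizer of `H` has dimension at most two. -/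
def HasSmallCentralizer (H : CompactG2) : Prop :=
  ∀ A B C : CompactG2, ⁅H, A⁆ = 0 → ⁅H, B⁆ = 0 → ⁅H, C⁆ = 0 → ¬LinearIndependent ℝ ![A, B, C]

theorem HasSmallCentralizer.map {H : CompactG2} (h : HasSmallCentralizer H)
    (φ : CompactG2 ≃ₗ⁅ℝ⁆ CompactG2) : HasSmallCentralizer (φ H) := by
  intro A B C hA hB hC hlin
  refine h (φ.symm A) (φ.symm B) (φ.symm C) ?_ ?_ ?_ ?_
  · apply φ.injective; simp [hA]
  · apply φ.injective; simp [hB]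
  · apply φ.injective; simp [hC]
  · have := hlin.map' φ.symm.toLinearEquiv.toLinearMap (LinearEquiv.ker _)
    convert! this using 1
    ext i : 1
    fin_cases i <;> rfl

/-- Standard generators of a copy of `𝔰𝔬(3)`. -/
structure IsSo3Triple {L : Type*} [LieRing L] (H X Y : L) : Prop where
  lie_H_X : ⁅H, X⁆ = Y
  lie_X_Y : ⁅X, Y⁆ = H
  lie_Y_H : ⁅Y, H⁆ = X

theorem IsSo3Triple.map {H X Y : CompactG2} (h : IsSo3Triple H X Y)
    (φ : CompactG2 ≃ₗ⁅ℝ⁆ CompactG2) : IsSo3Triple (φ H) (φ X) (φ Y) :=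
  ⟨by rw [← LieEquiv.map_lie, h.lie_H_X], by rw [← LieEquiv.map_lie, h.lie_X_Y],
    by rw [← LieEquiv.map_lie, h.lie_Y_H]⟩

theorem IsSo3Triple.apply_Y {H X Y : CompactG2} (h : IsSo3Triple H X Y) (x : Octonion) :
    Y.1 x = H.1 (X.1 x) - X.1 (H.1 x) := by rw [← h.lie_H_X, lie_val_apply]

theorem IsSo3Triple.apply_H {H X Y : CompactG2} (h : IsSo3Triple H X Y) (x : Octonion) :
    H.1 x = X.1 (Y.1 x) - Y.1 (X.1 x) := by rw [← h.lie_X_Y, lie_val_apply]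

theorem IsSo3Triple.apply_X {H X Y : CompactG2} (h : IsSo3Triple H X Y) (x : Octonion) :
    X.1 x = Y.1 (H.1 x) - H.1 (Y.1 x) := by rw [← h.lie_Y_H, lie_val_apply]

/-- A derivation of the octonions killing `i` and `j` comes from the second factor. -/
theorem eq_quatDer_of_uI_uJ {D : CompactG2} (hI : D.1 uI = 0) (hJ : D.1 uJ = 0) :
    ∃ q1 q2 q3, D = quatDer 0 0 0 q1 q2 q3 := by
  have hK : D.1 uK = 0 := by rw [der_uK, hI, hJ, zero_mul, mul_zero, add_zero]
  have h0 := der_dot_one D uL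
  have h1 := der_skew D uL uI
  have h2 := der_skew D uL uJ
  have h3 := der_skew D uL uK
  have h4 := der_dot_self D uL
  rw [hI] at h1
  rw [hJ] at h2
  rw [hK] at h3
  refine ⟨(D.1 uL).c5, (D.1 uL).c6, (D.1 uL).c7, ?_⟩
  simp [dot, uI, uJ, uK, uL] at h0 h1 h2 h3 h4
  apply der_ext
  · rw [hI, quatDer_apply]; apply ext_coord <;> simp [uI]
  · rw [hJ, quatDer_apply]; apply ext_coord <;> simp [uJ]
  · rw [quatDer_apply]; apply ext_coord <;> simp [uL, h0, h1, h2, h3, h4]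

/-- If u were nonzero, H would kill the quaternion subalgebra generated by v and u. In a frame
adapted to it H is `quatDer 0 0 0 q1 q2 q3`, which commutes with the three-dimensional first factor.
-/
theorem HasSmallCentralizer.eq_zero_of_der_eq_zero {H : CompactG2} (h : HasSmallCentralizer H)
    {v u : Octonion} (v1 : dot v 1 = 0) (vv : dot v v = 1) (hv : H.1 v = 0) (u1 : dot u 1 = 0)
    (uv : dot u v = 0) (hu : H.1 u = 0) : u = 0 := by
  by_contra hu0
  have hpos := dot_self_pos hu0
  set r := (√(dot u u))⁻¹ with hr
  obtain ⟨z, hz⟩ := exists_basicTriple (y := r • u) v1 (by rw [dot_smul_left, u1, mul_zero]) vv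
    (by rw [dot_smul_left, dot_smul_right, ← mul_assoc, hr, ← mul_inv,
      Real.mul_self_sqrt hpos.le, inv_mul_cancel₀ hpos.ne'])
    (by rw [dot_smul_right, dot_comm, uv, mul_zero])
  obtain ⟨Φ, hΦ, hI, hJ, -⟩ := hz.exists_isAut
  obtain ⟨q1, q2, q3, hq⟩ := eq_quatDer_of_uI_uJ (D := (conjEquiv hΦ).symm H)
    (conjEquiv_symm_apply_eq hΦ (by rw [hI, hv, map_zero]))
    (conjEquiv_symm_apply_eq hΦ (by rw [hJ, map_smul, hu, smul_zero, map_zero]))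
  refine (h.map (conjEquiv hΦ).symm) _ _ _ ?_ ?_ ?_ linearIndependent_quatDer_left <;>
    rw [hq, quatDer_lie, ← quatDer_zero] <;> simp


/-! ### The kernel of `H` and the action of `X` on it -/

/-- The coordinates of the octonions as a linear isomorphism. -/
noncomputable def coordEquiv : Octonion ≃ₗ[ℝ] (Fin 8 → ℝ) where
  toFun x := ![x.c0, x.c1, x.c2, x.c3, x.c4, x.c5, x.c6, x.c7]
  map_add' x y := by ext i; fin_cases i <;> simp
  map_smul' r x := by ext i; fin_cases i <;> simp
  invFun v := mk (v 0) (v 1) (v 2) (v 3) (v 4) (v 5) (v 6) (v 7)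
  left_inv x := by apply ext_coord <;> simp
  right_inv v := by ext i; fin_cases i <;> simp

theorem trace_eq (T : Module.End ℝ Octonion) : LinearMap.trace ℝ Octonion T =
    (T 1).c0 + (T uI).c1 + (T uJ).c2 + (T uK).c3 + (T uL).c4 + (T uIL).c5 + (T uJL).c6
      + (T uKL).c7 := by
  have h : ∀ i, Module.Basis.ofEquivFun coordEquiv i = ![1, uI, uJ, uK, uL, uIL, uJL, uKL] i := by
    intro i
    rw [Module.Basis.coe_ofEquivFun]
    fin_cases i <;> apply ext_coord <;> simp [coordEquiv, uI, uJ, uK, uL, uIL, uJL, uKL]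
  rw [LinearMap.trace_eq_matrix_trace ℝ (Module.Basis.ofEquivFun coordEquiv), Matrix.trace,
    Fin.sum_univ_eight]
  simp only [Matrix.diag_apply, LinearMap.toMatrix_apply, h, Module.Basis.ofEquivFun_repr_apply]
  rfl

/-- 𝔰𝔬(3) has no invariant cubic form. Since J commutes with X and Y, the functional T ↦ tr(JT)
vanishes on commutators with X or Y. Thus tr(JH³) = tr(JX[Y,H²]) = tr(JX(XH + HX)) = 2 tr(JX²H), and
X²H = [X, X²Y]. -/
theorem trace_mul_cube_eq_zero {K V : Type*} [Field K] [AddCommGroup V] [Module K V]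
    {J X Y H : Module.End K V} (hX : J * X = X * J) (hY : J * Y = Y * J)
    (hXY : X * Y - Y * X = H) (hYH : Y * H - H * Y = X) :
    LinearMap.trace K V (J * (H * (H * H))) = 0 := by
  have cyc := fun A B : Module.End K V => LinearMap.trace_mul_comm K A B
  have h0 : LinearMap.trace K V (J * X * X * H) = 0 := by
    have e : J * X * X * (X * Y - Y * X) = X * (J * X * X * Y) - J * X * X * Y * X
        + (J * X - X * J) * X * X * Y := by noncomm_ring
    rw [hXY, hX, sub_self, zero_mul, zero_mul, zero_mul, add_zero, ← hX] at e
    rw [e, map_sub, cyc X, sub_self]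
  have e : J * (X * Y - Y * X) * H * H = J * X * ((Y * H - H * Y) * H + H * (Y * H - H * Y))
      + (J * X * H * H * Y - Y * (J * X * H * H)) - (J * Y - Y * J) * X * H * H := by noncomm_ring
  have e' : J * X * (X * H + H * X) = J * X * X * H + J * X * H * X := by noncomm_ring
  have e'' : X * (J * X * H) = J * X * X * H - (J * X - X * J) * X * H := by noncomm_ring
  rw [hX, sub_self, zero_mul, zero_mul, sub_zero, ← hX] at e''
  rw [hXY, hYH, hY, sub_self, zero_mul, zero_mul, zero_mul, sub_zero, e'] at e
  rw [← mul_assoc, ← mul_assoc, e, map_add, map_add, map_sub, cyc Y, sub_self, h0,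
    cyc _ X, e'', h0, add_zero, add_zero]

/-- If Xv = 0, the whole triple kills v and commutes with J, left multiplication by v. On the
complex 3-space orthogonal to 1 and v, H then has weights a, b, -(a + b), and tr(JH³) = 0 makes one
of them vanish, so H kills a second direction. -/
theorem HasSmallCentralizer.der_ne_zero {H X Y : CompactG2} (hs : HasSmallCentralizer H)
    (t : IsSo3Triple H X Y) {v : Octonion} (v1 : dot v 1 = 0) (vv : dot v v = 1)
    (hv : H.1 v = 0) : X.1 v ≠ 0 := by
  intro hXv
  obtain ⟨Φ, hΦ, a, b, hI, hab⟩ := exists_conj_eq_torusDer v1 vv hv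
  have hs' := hs.map (conjEquiv hΦ).symm
  have t' := t.map (conjEquiv hΦ).symm
  have hXI : ((conjEquiv hΦ).symm X).1 uI = 0 :=
    conjEquiv_symm_apply_eq hΦ (by rw [hI, hXv, map_zero])
  have hHI : ((conjEquiv hΦ).symm H).1 uI = 0 :=
    conjEquiv_symm_apply_eq hΦ (by rw [hI, hv, map_zero])
  have hYI := t'.apply_Y uI
  rw [hXI, hHI, map_zero, map_zero, sub_zero] at hYI
  set H' := (conjEquiv hΦ).symm H
  set X' := (conjEquiv hΦ).symm X
  set Y' := (conjEquiv hΦ).symm Y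
  have comm : ∀ D : CompactG2, D.1 uI = 0 →
      LinearMap.mulLeft ℝ uI * D.1 = D.1 * LinearMap.mulLeft ℝ uI := by
    intro D hD
    ext1 x
    change uI * D.1 x = D.1 (uI * x)
    rw [der_mul, hD, zero_mul, zero_add]
  have tr := trace_mul_cube_eq_zero (comm X' hXI) (comm Y' hYI) (H := H'.1)
    (congrArg Subtype.val t'.lie_X_Y) (congrArg Subtype.val t'.lie_Y_H)
  rw [trace_eq] at tr
  simp only [Module.End.mul_apply, LinearMap.mulLeft_apply, hab, torusDer_apply] at tr
  simp [uI, uJ, uK, uL, uIL, uJL, uKL] at tr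
  -- The trace equals 2(a³ + b³ - (a + b)³) = -6ab(a + b).
  have habc : a * b * (a + b) = 0 := by linear_combination (-1 / 6) * tr
  have uI1 : dot uI 1 = 0 := by simp [dot, uI]
  have uII : dot uI uI = 1 := by simp [dot, uI]
  have key : ∀ u : Octonion, dot u 1 = 0 → dot u uI = 0 → H'.1 u = 0 → u = 0 := fun u h1 h2 h3 =>
    hs'.eq_zero_of_der_eq_zero uI1 uII hHI h1 h2 h3
  rcases mul_eq_zero.1 habc with h | h
  · rcases mul_eq_zero.1 h with h | h
    · have := key uJ (by simp [dot, uJ]) (by simp [dot, uI, uJ])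
        (by rw [hab, torusDer_apply]; apply ext_coord <;> simp [uJ, h])
      simpa [uJ] using congrArg c2 this
    · have := key uL (by simp [dot, uL]) (by simp [dot, uI, uL])
        (by rw [hab, torusDer_apply]; apply ext_coord <;> simp [uL, h])
      simpa [uL] using congrArg c4 this
  · have := key uJL (by simp [dot, uJL]) (by simp [dot, uI, uJL])
      (by rw [hab, torusDer_apply]; apply ext_coord <;> simp [uJL, h])
    simpa [uJL] using congrArg c6 this

/-- On a vector killed by H the relations reduce to Yv = HXv and Xv = -HYv. -/
theorem IsSo3Triple.der_der {H X Y : CompactG2} (t : IsSo3Triple H X Y) {v : Octonion}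
    (hv : H.1 v = 0) : H.1 (H.1 (X.1 v)) = -X.1 v := by
  have h1 := t.apply_Y v
  have h2 := t.apply_X v
  rw [hv, map_zero, sub_zero] at h1
  rw [hv, map_zero, zero_sub, h1] at h2
  exact (neg_eq_iff_eq_neg.2 h2).symm

/-- The vectors p and q are, up to a factor 2, the components of u on which H acts as v and as -v.
Their product has weight zero and is orthogonal to 1 and v, so it vanishes by the small centralizer;
the norm being multiplicative, p or q is zero. -/
theorem HasSmallCentralizer.der_eq_or {H : CompactG2} (hs : HasSmallCentralizer H)
    {v u : Octonion} (v1 : dot v 1 = 0) (vv : dot v v = 1) (hv : H.1 v = 0) (u1 : dot u 1 = 0)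
    (uv : dot u v = 0) (hu : H.1 (H.1 u) = -u) : H.1 u = v * u ∨ H.1 u = -(v * u) := by
  have hvv := mul_self_of_unit v1 vv
  set p := u - v * H.1 u with hp
  set q := u + v * H.1 u with hq
  have hHv : ∀ x, H.1 (v * x) = v * H.1 x := fun x => by rw [der_mul, hv, zero_mul, zero_add]
  have hHp : H.1 p = v * p := by
    rw [hp, map_sub, hHv, hu, mul_sub, mul_mul_self hvv, mul_neg]; abel
  have hHq : H.1 q = -(v * q) := by
    rw [hq, map_add, hHv, hu, mul_add, mul_mul_self hvv, mul_neg]; abel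
  have a1 : dot (v * H.1 u) 1 = 0 := by
    rw [dot_mul_one _ _ v1, dot_comm, der_skew, hv, dot_zero_right, neg_zero, neg_zero]
  have av : dot (v * H.1 u) v = 0 := by rw [dot_mul_left_self, der_dot_one, mul_zero]
  have p1 : dot p 1 = 0 := by rw [hp, dot_sub_left, u1, a1, sub_zero]
  have pv : dot p v = 0 := by rw [hp, dot_sub_left, uv, av, sub_zero]
  have q1 : dot q 1 = 0 := by rw [hq, dot_add_left, u1, a1, add_zero]
  have qv : dot q v = 0 := by rw [hq, dot_add_left, uv, av, add_zero]
  have pq : dot p q = 0 := by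
    have h1 : dot (H.1 p) (H.1 q) = -dot p q := by
      rw [hHp, hHq, dot_neg_right, dot_mul_mul_left, vv, one_mul]
    have h2 : dot (H.1 p) (H.1 q) = dot p q := by
      rw [der_skew, hHq, map_neg, hHv, hHq, mul_neg, mul_mul_self hvv, neg_neg, dot_neg_right,
        neg_neg]
    linarith
  have vpq : dot (v * p) q = 0 := by
    have h1 := der_skew H p q
    rw [hHp, hHq, dot_neg_right, neg_neg] at h1
    have h2 := dot_mul_left_skew v1 p q
    linarith
  have hpq : H.1 (p * q) = 0 := by
    have pq1 : dot (p * q) 1 = 0 := by rw [dot_mul_one _ _ p1, pq, neg_zero]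
    have pqv : dot (p * q) v = 0 := by
      rw [dot_mul_left_skew p1, anticomm v1 p1 ((dot_comm _ _).trans pv), dot_neg_right,
        dot_comm, vpq, neg_zero, neg_zero]
    -- As v anticommutes with p and with q, both alternative laws lose their right-hand sides. They
    -- identify v(pq), p(vq) and (vp)q up to sign, which cancels the two terms of H(pq).
    have e1 := left_alternative v p q
    have e2 := right_alternative v q p
    rw [anticomm v1 p1 ((dot_comm _ _).trans pv), add_neg_cancel, zero_mul] at e1
    rw [anticomm v1 q1 ((dot_comm _ _).trans qv), add_neg_cancel, mul_zero] at e2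
    rw [der_mul, hHp, hHq, mul_neg]
    have e3 : (v * p) * q = (p * q) * v := by
      rw [anticomm p1 v1 pv, neg_mul, neg_eq_iff_add_eq_zero, e2]
    have e4 : (p * q) * v = -(v * (p * q)) := anticomm v1 pq1 ((dot_comm _ _).trans pqv)
    rw [e3, e4, ← neg_add, e1, neg_zero]
  have pq0 : p * q = 0 := by
    apply hs.eq_zero_of_der_eq_zero v1 vv hv _ _ hpq
    · rw [dot_mul_one _ _ p1, pq, neg_zero]
    · rw [dot_mul_left_skew p1, anticomm v1 p1 ((dot_comm _ _).trans pv), dot_neg_right,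
        dot_comm, vpq, neg_zero, neg_zero]
  have hn := dot_mul_mul_left p q q
  rw [pq0, dot_zero_left, eq_comm, mul_eq_zero] at hn
  rcases hn with h | h
  · right
    have h0 := eq_zero_of_dot_self h
    rw [hp, sub_eq_zero] at h0
    conv_rhs => rw [h0, mul_mul_self hvv, neg_neg]
  · left
    have h0 := eq_zero_of_dot_self h
    rw [hq, add_eq_zero_iff_eq_neg] at h0
    conv_rhs => rw [h0, mul_neg, mul_mul_self hvv, neg_neg]

/-- In a suitable frame, `H` and `X` preserve the quaternion subalgebra up to a component. -/
theorem exists_conj_frame {H X Y : CompactG2} (hs : HasSmallCentralizer H)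
    (t : IsSo3Triple H X Y) : ∃ (Φ : Octonion ≃ₗ[ℝ] Octonion) (h : IsAut Φ) (s : ℝ), 0 < s ∧
      ((conjEquiv h).symm H).1 uI = 0 ∧ ((conjEquiv h).symm H).1 uJ = uK ∧
      ((conjEquiv h).symm X).1 uI = s • uJ := by
  -- The kernel vector is defined up to sign; replacing v by -v selects the sign + in `der_eq_or`.
  obtain ⟨v, v1, vv, hv, hXv⟩ : ∃ v, dot v 1 = 0 ∧ dot v v = 1 ∧ H.1 v = 0 ∧
      H.1 (X.1 v) = v * X.1 v := by
    obtain ⟨v, v1, vv, hv⟩ := exists_unit_der_eq_zero H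
    rcases hs.der_eq_or v1 vv hv (der_dot_one X v) (der_dot_self X v) (t.der_der hv) with h | h
    · exact ⟨v, v1, vv, hv, h⟩
    · refine ⟨-v, by rw [dot_neg_left, v1, neg_zero], by rw [dot_neg_left, dot_neg_right, neg_neg, vv],
        by rw [map_neg, hv, neg_zero], ?_⟩
      rw [map_neg, map_neg, h, neg_mul_neg, neg_neg]
  have hX0 := hs.der_ne_zero t v1 vv hv
  have hpos := dot_self_pos hX0
  set s := √(dot (X.1 v) (X.1 v)) with hsdef
  have spos : 0 < s := Real.sqrt_pos.2 hpos
  obtain ⟨z, hz⟩ := exists_basicTriple (x := v) (y := s⁻¹ • X.1 v) v1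
    (by rw [dot_smul_left, der_dot_one, mul_zero]) vv
    (by rw [dot_smul_left, dot_smul_right, ← mul_assoc, hsdef, ← mul_inv,
      Real.mul_self_sqrt hpos.le, inv_mul_cancel₀ hpos.ne'])
    (by rw [dot_smul_right, dot_comm, der_dot_self, mul_zero])
  obtain ⟨Φ, hΦ, hI, hJ, -⟩ := hz.exists_isAut
  refine ⟨Φ, hΦ, s, spos, ?_, ?_, ?_⟩ <;> apply conjEquiv_symm_apply_eq
  · rw [hI, hv, map_zero]
  · rw [hJ, map_smul, hXv, ← uI_mul_uJ, hΦ, hI, hJ, mul_smul_comm]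
  · rw [hI, map_smul, hJ, smul_inv_smul₀ spos.ne']


/-! ### The adapted frame and the normal form -/

section frame

variable {H X Y : CompactG2}

theorem dot_uI_one : dot uI 1 = 0 := by simp [dot, uI]
theorem dot_uJ_one : dot uJ 1 = 0 := by simp [dot, uJ]
theorem dot_uI_uI : dot uI uI = 1 := by simp [dot, uI]
theorem dot_uJ_uJ : dot uJ uJ = 1 := by simp [dot, uJ]
theorem dot_uI_uJ : dot uI uJ = 0 := by simp [dot, uI, uJ]
theorem uI_mul_uI : uI * uI = -1 := by apply ext_coord <;> simp [uI]
theorem uJ_mul_uJ : uJ * uJ = -1 := by apply ext_coord <;> simp [uJ]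
theorem uK_mul_uJ : uK * uJ = -uI := by apply ext_coord <;> simp [uK, uI, uJ]
theorem uI_mul_uK : uI * uK = -uJ := by apply ext_coord <;> simp [uK, uI, uJ]

/-- A derivation rotating the quaternion subalgebra and killing no vector of its orthogonal
complement cannot be completed inside the stabilizer of the quaternion subalgebra. -/
theorem HasSmallCentralizer.not_stable (hs : HasSmallCentralizer H) (t : IsSo3Triple H X Y)
    {s : ℝ} (hHI : H.1 uI = 0) (hHJ : H.1 uJ = uK) (hXI : X.1 uI = s • uJ)
    (hXJ : X.1 uJ = -(s • uI)) : False := by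
  have hHK : H.1 uK = -uJ := by rw [der_uK, hHI, hHJ, zero_mul, zero_add, uI_mul_uK]
  have hXK : X.1 uK = 0 := by
    rw [der_uK, hXI, hXJ, smul_mul_assoc, mul_neg, mul_smul_comm, uI_mul_uI, uJ_mul_uJ,
      add_neg_cancel]
  -- H and X both preserve the quaternions, hence so does their triple, and it lies in the sum of
  -- the two 𝔰𝔬(3) factors. Skewness leaves only the coordinates of the images of l along il, jl, kl
  -- to be named.
  obtain ⟨a1, a2, a3, hH⟩ : ∃ a1 a2 a3, H = quatDer (1 / 2) 0 0 a1 a2 a3 := by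
    refine ⟨(H.1 uL).c5 + 1 / 2, (H.1 uL).c6, (H.1 uL).c7, ?_⟩
    have h0 := der_dot_one H uL
    have h1 := der_skew H uL uI
    have h2 := der_skew H uL uJ
    have h3 := der_skew H uL uK
    have h4 := der_dot_self H uL
    rw [hHI] at h1
    rw [hHJ] at h2
    rw [hHK] at h3
    simp [dot, uI, uJ, uK, uL] at h0 h1 h2 h3 h4
    apply der_ext
    · rw [hHI, quatDer_apply]; apply ext_coord <;> simp [uI]
    · rw [hHJ, quatDer_apply]; apply ext_coord <;> simp [uJ, uK]
    · rw [quatDer_apply]; apply ext_coord <;> simp [uL, h0, h1, h2, h3, h4]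
  obtain ⟨b1, b2, b3, hX⟩ : ∃ b1 b2 b3, X = quatDer 0 0 (s / 2) b1 b2 b3 := by
    refine ⟨(X.1 uL).c5, (X.1 uL).c6, (X.1 uL).c7 + s / 2, ?_⟩
    have h0 := der_dot_one X uL
    have h1 := der_skew X uL uI
    have h2 := der_skew X uL uJ
    have h3 := der_skew X uL uK
    have h4 := der_dot_self X uL
    rw [hXI] at h1
    rw [hXJ] at h2
    rw [hXK] at h3
    simp [dot, uI, uJ, uK, uL] at h0 h1 h2 h3 h4
    apply der_ext
    · rw [hXI, quatDer_apply]; apply ext_coord <;> simp [uI, uJ]; ring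
    · rw [hXJ, quatDer_apply]; apply ext_coord <;> simp [uJ, uI]; ring
    · rw [quatDer_apply]; apply ext_coord <;> simp [uL, h0, h1, h2, h3, h4]
  have hY := t.lie_H_X
  rw [hH, hX, quatDer_lie] at hY
  have e1 := t.lie_X_Y
  have e2 := t.lie_Y_H
  rw [← hY, hX, hH, quatDer_lie] at e1
  rw [← hY, hX, hH, quatDer_lie] at e2
  obtain ⟨-, -, -, f1, f2, f3⟩ := quatDer_inj e1
  obtain ⟨-, -, -, g1, g2, g3⟩ := quatDer_inj e2
  -- The components in the second factor satisfy the same relations. Either the component of H is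
  -- zero, and H commutes with that whole factor, or it has the same norm 1/2 as the component in
  -- the first factor.
  by_cases h0 : a1 = 0 ∧ a2 = 0 ∧ a3 = 0
  · obtain ⟨rfl, rfl, rfl⟩ := h0
    refine hs _ _ _ ?_ ?_ ?_ linearIndependent_quatDer_right <;>
      rw [hH, quatDer_lie, ← quatDer_zero] <;> simp
  have hdot : a1 * b1 + a2 * b2 + a3 * b3 = 0 := by
    linear_combination (-b1) * f1 + (-b2) * f2 + (-b3) * f3
  have hb : ∀ b, b = b1 ∨ b = b2 ∨ b = b3 → (4 * (a1 ^ 2 + a2 ^ 2 + a3 ^ 2) - 1) * b = 0 := by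
    rintro b (rfl | rfl | rfl)
    · linear_combination g1 + 4 * a1 * hdot
    · linear_combination g2 + 4 * a2 * hdot
    · linear_combination g3 + 4 * a3 * hdot
  have hnorm : 4 * (a1 ^ 2 + a2 ^ 2 + a3 ^ 2) - 1 = 0 := by
    by_contra hne
    have hb1 := (mul_eq_zero.1 (hb b1 (by simp))).resolve_left hne
    have hb2 := (mul_eq_zero.1 (hb b2 (by simp))).resolve_left hne
    have hb3 := (mul_eq_zero.1 (hb b3 (by simp))).resolve_left hne
    rw [hb1, hb2, hb3] at f1 f2 f3
    apply h0
    refine ⟨?_, ?_, ?_⟩ <;> linarith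
  have key : ∀ u : Octonion, dot u 1 = 0 → dot u uI = 0 → H.1 u = 0 → u = 0 := fun u h1 h2 h3 =>
    hs.eq_zero_of_der_eq_zero dot_uI_one dot_uI_uI hHI h1 h2 h3
  -- On bl, H acts by b ↦ qb - bp with p = i/2 and q = a1 i + a2 j + a3 k. Since |q| = |p|, one has
  -- q² = p², so b = q + p is killed.
  have k1 := key (mk 0 0 0 0 0 (a1 + 1 / 2) a2 a3) (by simp [dot]) (by simp [dot, uI])
    (by
      rw [hH, quatDer_apply]
      apply ext_coord <;> simp <;>
        first | ring1 | linear_combination (-1 / 4) * hnorm)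
  have m1 := congrArg c5 k1
  have m2 := congrArg c6 k1
  have m3 := congrArg c7 k1
  simp at m1 m2 m3
  -- The remaining case is q = -p, where b = j is killed instead.
  have k2 := key uJL (by simp [dot, uJL]) (by simp [dot, uI, uJL])
    (by
      rw [hH, quatDer_apply]
      apply ext_coord <;> simp [uJL, m2, m3]
      linarith)
  simpa [uJL] using congrArg c6 k2

/-- The component w of Xj transverse to i supplies the third frame vector. It is nonzero, as
otherwise the triple would preserve the quaternions, which `not_stable` excludes. -/
theorem HasSmallCentralizer.exists_frame (hs : HasSmallCentralizer H) (t : IsSo3Triple H X Y)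
    {s : ℝ} (hHI : H.1 uI = 0) (hHJ : H.1 uJ = uK) (hXI : X.1 uI = s • uJ) :
    ∃ (z : Octonion) (r : ℝ), 0 < r ∧ IsBasicTriple uI uJ z ∧ H.1 z = (2 : ℝ) • (uI * z) ∧
      X.1 uJ = -(s • uI) + r • z := by
  set w := X.1 uJ + s • uI with hw
  have hXJ : X.1 uJ = -(s • uI) + w := by rw [hw]; abel
  have hHi : ∀ x, H.1 (uI * x) = uI * H.1 x := fun x => by
    rw [der_mul, hHI, zero_mul, zero_add]
  have hHK : H.1 uK = -uJ := by rw [der_uK, hHI, hHJ, zero_mul, zero_add, uI_mul_uK]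
  have hXK : X.1 uK = uI * w := by
    rw [der_uK, hXI, hXJ, smul_mul_assoc, mul_add, mul_neg, mul_smul_comm, uI_mul_uI, uJ_mul_uJ]
    abel
  have hYI : Y.1 uI = s • uK := by
    rw [t.apply_Y, hXI, hHI, map_zero, sub_zero, map_smul, hHJ]
  have hYJ : Y.1 uJ = H.1 w - uI * w := by
    rw [t.apply_Y, hHJ, hXK, hXJ, map_add, map_neg, map_smul, hHI, smul_zero, neg_zero, zero_add]
  have hYK : Y.1 uK = -(s • uI) + (uI * H.1 w + w) := by
    rw [der_uK, hYI, hYJ, smul_mul_assoc, uK_mul_uJ, mul_sub, mul_mul_self uI_mul_uI, smul_neg,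
      sub_neg_eq_add]
  -- The relation X = [Y,H] evaluated at j says that H² w = 2i(Hw). The vector in parentheses is
  -- orthogonal to 1 and i, so it must be zero.
  have hww : H.1 (H.1 w - (2 : ℝ) • (uI * w)) = 0 := by
    have := t.apply_X uJ
    rw [hHJ, hYJ, hYK, hXJ, map_sub, hHi] at this
    rw [map_sub, map_smul, hHi, two_smul]
    have h2 : H.1 (H.1 w) - (uI * H.1 w + uI * H.1 w) =
      (-(s • uI) + (uI * H.1 w + w) - (-(s • uI) + w)) - uI * H.1 w
        + (H.1 (H.1 w) - uI * H.1 w - uI * H.1 w) := by abel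
    have h3 : H.1 (H.1 w) - uI * H.1 w = uI * H.1 w := by
      have h4 : H.1 (H.1 w) - uI * H.1 w =
        (-(s • uI) + (uI * H.1 w + w)) - ((-(s • uI) + (uI * H.1 w + w)) -
          (H.1 (H.1 w) - uI * H.1 w)) := by abel
      rw [h4, ← this]; abel
    rw [sub_add_eq_sub_sub, h3, sub_self]
  have w1 : dot w 1 = 0 := by
    rw [hw, dot_add_left, der_dot_one, dot_smul_left, dot_uI_one, mul_zero, add_zero]
  have wI : dot w uI = 0 := by
    rw [hw, dot_add_left, der_skew, hXI, dot_smul_right, dot_smul_left, dot_uI_uI, dot_uJ_uJ]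
    ring
  have wJ : dot w uJ = 0 := by
    rw [hw, dot_add_left, der_dot_self, dot_smul_left, dot_uI_uJ, mul_zero, add_zero]
  have hHw : H.1 w = (2 : ℝ) • (uI * w) := by
    rw [← sub_eq_zero]
    refine hs.eq_zero_of_der_eq_zero dot_uI_one dot_uI_uI hHI ?_ ?_ hww
    · rw [dot_sub_left, der_dot_one, dot_smul_left, dot_mul_one _ _ dot_uI_one, dot_comm, wI]
      simp
    · rw [dot_sub_left, der_skew, hHI, dot_zero_right, dot_smul_left, dot_mul_left_self, w1]
      simp
  -- Skewness gives ⟨Hw, j⟩ = -⟨w, k⟩, while Hw = 2iw gives -2⟨w, k⟩.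
  have wK : dot w uK = 0 := by
    have h1 := der_skew H w uJ
    rw [hHJ, hHw, dot_smul_left, dot_mul_left_skew dot_uI_one, uI_mul_uJ] at h1
    linarith
  have hw0 : w ≠ 0 := by
    intro h0
    rw [h0, add_zero] at hXJ
    exact hs.not_stable t hHI hHJ hXI hXJ
  have hpos := dot_self_pos hw0
  set r := √(dot w w) with hr
  have rpos : 0 < r := Real.sqrt_pos.2 hpos
  refine ⟨r⁻¹ • w, r, rpos, ⟨dot_uI_one, dot_uJ_one, ?_, dot_uI_uI, dot_uJ_uJ, ?_, dot_uI_uJ,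
    ?_, ?_, ?_⟩, ?_, ?_⟩
  · rw [dot_smul_left, w1, mul_zero]
  · rw [dot_smul_left, dot_smul_right, ← mul_assoc, hr, ← mul_inv,
      Real.mul_self_sqrt hpos.le, inv_mul_cancel₀ hpos.ne']
  · rw [dot_smul_right, dot_comm, wI, mul_zero]
  · rw [dot_smul_right, dot_comm, wJ, mul_zero]
  · rw [dot_smul_right, uI_mul_uJ, dot_comm, wK, mul_zero]
  · rw [map_smul, hHw, mul_smul_comm, smul_comm]
  · rw [smul_inv_smul₀ rpos.ne', hXJ]

theorem IsSo3Triple.eq_standard (t : IsSo3Triple H X Y) {s r : ℝ} (hs : 0 < s) (hr : 0 < r)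
    (hHI : H.1 uI = 0) (hHJ : H.1 uJ = uK) (hHL : H.1 uL = (2 : ℝ) • uIL)
    (hXI : X.1 uI = s • uJ) (hXJ : X.1 uJ = -(s • uI) + r • uL) :
    H = torusDer 1 2 ∧ X = mixedDer (√6) (√(5 / 2)) := by
  have hH : H = torusDer 1 2 := by
    apply der_ext <;> rw [torusDer_apply]
    · rw [hHI]; apply ext_coord <;> simp [uI]
    · rw [hHJ]; apply ext_coord <;> simp [uJ, uK]
    · rw [hHL]; apply ext_coord <;> simp [uL, uIL]
  have hXK : X.1 uK = r • uIL := by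
    rw [der_uK, hXI, hXJ]; apply ext_coord <;> simp [uI, uJ, uL, uIL]
  have hX : X = mixedDer s r := by
    have h0 := der_dot_one X uL
    have h1 := der_skew X uL uI
    have h2 := der_skew X uL uJ
    have h3 := der_skew X uL uK
    have h4 := der_dot_self X uL
    rw [hXI] at h1
    rw [hXJ] at h2
    rw [hXK] at h3
    simp [dot, uI, uJ, uK, uL, uIL] at h0 h1 h2 h3 h4
    -- Skewness fixes Xl along 1, i, j, k, l; the relation X = [Y,H] at l fixes its components along
    -- il, jl, kl.
    have e := t.apply_X uL
    rw [hHL, map_smul, der_uIL, t.apply_Y uL, t.apply_Y uI, hHI, hHL, map_smul, der_uIL X, hXI,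
      hH] at e
    simp only [torusDer_apply] at e
    have e5 := congrArg c5 e
    have e6 := congrArg c6 e
    have e7 := congrArg c7 e
    simp [uI, uJ, uL, h0, h1, h2, h3, h4] at e5 e6 e7
    have x5 : (X.1 (Octonion.mk 0 0 0 0 1 0 0 0)).c5 = 0 := by linarith
    have x6 : (X.1 (Octonion.mk 0 0 0 0 1 0 0 0)).c6 = 0 := by linarith
    have x7 : (X.1 (Octonion.mk 0 0 0 0 1 0 0 0)).c7 = -(s / 2) := by linarith
    apply der_ext <;> rw [mixedDer_apply]
    · rw [hXI]; apply ext_coord <;> simp [uI, uJ]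
    · rw [hXJ]; apply ext_coord <;> simp [uJ, uI, uL]
    · apply ext_coord <;> simp [uL, h0, h1, h2, h3, h4, x5, x6, x7]
  -- The scalars s and r come from [X,Y] = H, read on j along k and on l along il; positivity then
  -- selects the roots.
  have eJ := t.apply_H uJ
  have eL := t.apply_H uL
  rw [t.apply_Y, t.apply_Y, hH, hX] at eJ eL
  simp only [torusDer_apply, mixedDer_apply] at eJ eL
  have e1 := congrArg c3 eJ
  have e2 := congrArg c5 eL
  simp [uJ, uL] at e1 e2
  have hs6 : s ^ 2 = 6 := by linear_combination (-2) * e1 - 2 * e2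
  have hr6 : r ^ 2 = 5 / 2 := by linear_combination (1 / 2) * hs6 + (1 / 2) * e1
  refine ⟨hH, ?_⟩
  rw [hX, ← hs6, ← hr6, Real.sqrt_sq hs.le, Real.sqrt_sq hr.le]

end frame

/-- Any copy of `𝔰𝔬(3)` with regular `H` is conjugate to the standard one. -/
theorem HasSmallCentralizer.exists_conj_eq_standard {H X Y : CompactG2}
    (hs : HasSmallCentralizer H) (t : IsSo3Triple H X Y) : ∃ φ : CompactG2 ≃ₗ⁅ℝ⁆ CompactG2,
      φ H = torusDer 1 2 ∧ φ X = mixedDer (√6) (√(5 / 2)) := by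
  obtain ⟨Φ, hΦ, s, spos, hHI, hHJ, hXI⟩ := exists_conj_frame hs t
  have hs' := hs.map (conjEquiv hΦ).symm
  have t' := t.map (conjEquiv hΦ).symm
  obtain ⟨z, r, rpos, hz, hHz, hXJ⟩ := hs'.exists_frame t' hHI hHJ hXI
  obtain ⟨Ψ, hΨ, hI, hJ, hL⟩ := hz.exists_isAut
  refine ⟨(conjEquiv hΦ).symm.trans (conjEquiv hΨ).symm, ?_⟩
  refine (t'.map (conjEquiv hΨ).symm).eq_standard spos rpos ?_ ?_ ?_ ?_ ?_ <;>
    apply conjEquiv_symm_apply_eq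
  · rw [hI, hHI, map_zero]
  · rw [hJ, hHJ, ← uI_mul_uJ, hΨ, hI, hJ]
  · rw [hL, hHz, map_smul, ← uI_mul_uL, hΨ, hI, hL]
  · rw [hI, hXI, map_smul, hJ]
  · rw [hJ, hXJ, map_add, map_neg, map_smul, map_smul, hI, hL]


/-! ### Coordinates on 𝔤₂ and the centralizer of the nilpotent element -/

/-- Skewness determines all but fourteen coordinates of the images of i, j and l, which matches dim
𝔤₂ = 14; the Leibniz rule gives the other images. -/
theorem der_apply_coord (D : CompactG2) (x : Octonion) : D.1 x = mk 0
      (-(D.1 uI).c2 * x.c2 - (D.1 uI).c3 * x.c3 - (D.1 uI).c4 * x.c4 - (D.1 uI).c5 * x.c5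
         - (D.1 uI).c6 * x.c6 - (D.1 uI).c7 * x.c7)
      ((D.1 uI).c2 * x.c1 - (D.1 uJ).c3 * x.c3 - (D.1 uJ).c4 * x.c4 - (D.1 uJ).c5 * x.c5
         - (D.1 uJ).c6 * x.c6 - (D.1 uJ).c7 * x.c7)
      ((D.1 uI).c3 * x.c1 + (D.1 uJ).c3 * x.c2 + ((D.1 uJ).c5 - (D.1 uI).c6) * x.c4 - ((D.1 uI).c7 + (D.1 uJ).c4) * x.c5
         + ((D.1 uI).c4 - (D.1 uJ).c7) * x.c6 + ((D.1 uI).c5 + (D.1 uJ).c6) * x.c7)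
      ((D.1 uI).c4 * x.c1 + (D.1 uJ).c4 * x.c2 + ((D.1 uI).c6 - (D.1 uJ).c5) * x.c3 - (D.1 uL).c5 * x.c5
         - (D.1 uL).c6 * x.c6 - (D.1 uL).c7 * x.c7)
      ((D.1 uI).c5 * x.c1 + (D.1 uJ).c5 * x.c2 + ((D.1 uI).c7 + (D.1 uJ).c4) * x.c3 + (D.1 uL).c5 * x.c4
         - ((D.1 uI).c2 + (D.1 uL).c7) * x.c6 + ((D.1 uL).c6 - (D.1 uI).c3) * x.c7)
      ((D.1 uI).c6 * x.c1 + (D.1 uJ).c6 * x.c2 + ((D.1 uJ).c7 - (D.1 uI).c4) * x.c3 + (D.1 uL).c6 * x.c4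
         + ((D.1 uI).c2 + (D.1 uL).c7) * x.c5 - ((D.1 uJ).c3 + (D.1 uL).c5) * x.c7)
      ((D.1 uI).c7 * x.c1 + (D.1 uJ).c7 * x.c2 - ((D.1 uI).c5 + (D.1 uJ).c6) * x.c3 + (D.1 uL).c7 * x.c4
         + ((D.1 uI).c3 - (D.1 uL).c6) * x.c5 + ((D.1 uJ).c3 + (D.1 uL).c5) * x.c6) := by
  have i0 := der_dot_one D uI
  have i1 := der_dot_self D uI
  have j0 := der_dot_one D uJ
  have j1 := der_skew D uJ uI
  have j2 := der_dot_self D uJ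
  have l0 := der_dot_one D uL
  have l1 := der_skew D uL uI
  have l2 := der_skew D uL uJ
  have l3 := der_skew D uL uK
  have l4 := der_dot_self D uL
  rw [der_uK] at l3
  rw [der_apply, der_uIL, der_uJL, der_uKL, der_uK]
  generalize D.1 uI = a at *
  generalize D.1 uJ = b at *
  generalize D.1 uL = c at *
  simp [dot, uI, uJ, uK, uL] at i0 i1 j0 j1 j2 l0 l1 l2 l3 l4
  apply ext_coord <;>
    simp [uI, uJ, uK, uL, i0, i1, j0, j1, j2, l0, l1, l2, l3, l4] <;> ring

-- The hypotheses `h1` and `h2` are the real and imaginary parts of [A + iB, X + iY] = 0. The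
-- statement says that two complex coordinates separate the points of the centralizer of X + iY,
-- whence its dimension is at most two.
set_option maxHeartbeats 1600000 in
theorem centralizer_mixedDer {s r : ℝ} (hs : s ≠ 0) (hr : r ≠ 0) {X Y A B : CompactG2}
    (hX : X = mixedDer s r) (hY : Y = ⁅torusDer 1 2, X⁆) (h1 : ⁅A, X⁆ = ⁅B, Y⁆)
    (h2 : ⁅A, Y⁆ = -⁅B, X⁆) (hAi : (A.1 uI).c2 = 0) (hBi : (B.1 uI).c2 = 0)
    (hAl : (A.1 uL).c6 = 0) (hBl : (B.1 uL).c6 = 0) : A = 0 ∧ B = 0 := by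
  have hY' : ∀ x, Y.1 x = mk 0 (-(s * x.c3)) (-(r * x.c5)) (s * x.c1 + r * x.c4)
      (-(r * x.c3) - s / 2 * x.c6) (r * x.c2 - s / 2 * x.c7) (s / 2 * x.c4)
      (s / 2 * x.c5) := fun x => by
    rw [hY, lie_val_apply, hX]
    simp only [mixedDer_apply, torusDer_apply]
    apply ext_coord <;> simp <;> ring
  have e1 : ∀ x, A.1 (X.1 x) - X.1 (A.1 x) = B.1 (Y.1 x) - Y.1 (B.1 x) := fun x =>
    congrArg (fun D : CompactG2 => D.1 x) h1
  have e2 : ∀ x, A.1 (Y.1 x) - Y.1 (A.1 x) = -(B.1 (X.1 x) - X.1 (B.1 x)) := fun x =>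
    congrArg (fun D : CompactG2 => D.1 x) h2
  simp only [hY', hX, mixedDer_apply] at e1 e2
  have hA := der_apply_coord A
  have hB := der_apply_coord B
  rw [hAi, hAl] at hA
  rw [hBi, hBl] at hB
  generalize (A.1 uI).c3 = ai3 at hA
  generalize (A.1 uI).c4 = ai4 at hA
  generalize (A.1 uI).c5 = ai5 at hA
  generalize (A.1 uI).c6 = ai6 at hA
  generalize (A.1 uI).c7 = ai7 at hA
  generalize (A.1 uJ).c3 = aj3 at hA
  generalize (A.1 uJ).c4 = aj4 at hA
  generalize (A.1 uJ).c5 = aj5 at hA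
  generalize (A.1 uJ).c6 = aj6 at hA
  generalize (A.1 uJ).c7 = aj7 at hA
  generalize (A.1 uL).c5 = al5 at hA
  generalize (A.1 uL).c7 = al7 at hA
  generalize (B.1 uI).c3 = bi3 at hB
  generalize (B.1 uI).c4 = bi4 at hB
  generalize (B.1 uI).c5 = bi5 at hB
  generalize (B.1 uI).c6 = bi6 at hB
  generalize (B.1 uI).c7 = bi7 at hB
  generalize (B.1 uJ).c3 = bj3 at hB
  generalize (B.1 uJ).c4 = bj4 at hB
  generalize (B.1 uJ).c5 = bj5 at hB
  generalize (B.1 uJ).c6 = bj6 at hB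
  generalize (B.1 uJ).c7 = bj7 at hB
  generalize (B.1 uL).c5 = bl5 at hB
  generalize (B.1 uL).c7 = bl7 at hB
  have xI2 := congrArg c2 (e1 uI)
  have xI3 := congrArg c3 (e1 uI)
  have xI4 := congrArg c4 (e1 uI)
  have xI5 := congrArg c5 (e1 uI)
  have xI6 := congrArg c6 (e1 uI)
  have xI7 := congrArg c7 (e1 uI)
  have xJ3 := congrArg c3 (e1 uJ)
  have xJ4 := congrArg c4 (e1 uJ)
  have xJ5 := congrArg c5 (e1 uJ)
  have xJ6 := congrArg c6 (e1 uJ)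
  have xJ7 := congrArg c7 (e1 uJ)
  have xL5 := congrArg c5 (e1 uL)
  have xL6 := congrArg c6 (e1 uL)
  have yI2 := congrArg c2 (e2 uI)
  have yI3 := congrArg c3 (e2 uI)
  have yI4 := congrArg c4 (e2 uI)
  have yI5 := congrArg c5 (e2 uI)
  have yI6 := congrArg c6 (e2 uI)
  have yI7 := congrArg c7 (e2 uI)
  have yJ3 := congrArg c3 (e2 uJ)
  have yJ4 := congrArg c4 (e2 uJ)
  have yJ5 := congrArg c5 (e2 uJ)
  have yJ6 := congrArg c6 (e2 uJ)
  have yJ7 := congrArg c7 (e2 uJ)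
  have yL5 := congrArg c5 (e2 uL)
  have yL6 := congrArg c6 (e2 uL)
  simp only [hA, hB, c1_mk, c2_mk, c2_sub, c2_neg, c3_mk, c3_sub, c3_neg, c4_mk, c4_sub, c4_neg, c5_mk, c5_sub,
    c5_neg, c6_mk, c6_sub, c6_neg, c7_mk, c7_sub, c7_neg]
    at xI2 xI3 xI4 xI5 xI6 xI7 xJ3 xJ4 xJ5
      xJ6 xJ7 xL5 xL6 yI2 yI3 yI4 yI5 yI6 yI7 yJ3 yJ4 yJ5 yJ6 yJ7 yL5 yL6
  simp only [uI, uJ, uL, c1_mk, c2_mk, c3_mk, c4_mk, c5_mk, c6_mk, c7_mk]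
    at xI2 xI3 xI4
      xI5 xI6 xI7 xJ3 xJ4 xJ5 xJ6 xJ7 xL5 xL6 yI2 yI3 yI4 yI5 yI6 yI7 yJ3 yJ4 yJ5 yJ6 yJ7 yL5 yL6
  -- What remains is a homogeneous linear system in 24 real unknowns. Suitable combinations isolate
  -- s or r times one unknown, or times a sum or difference of two, and s and r are nonzero.
  have zAj3 : aj3 = 0 := (mul_eq_zero.1 (show s * aj3 = 0 by
    linear_combination (-1/2) * yI2 + (1/2) * xI3)).resolve_left hs
  have zBj3 : bj3 = 0 := (mul_eq_zero.1 (show s * bj3 = 0 by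
    linear_combination (1/2) * yI3 + (1/2) * xI2)).resolve_left hs
  have zAi6 : ai6 = 0 := (mul_eq_zero.1 (show s * ai6 = 0 by
    linear_combination (5/12) * yI4 + (1/12) * xI5 + (-1/3) * yJ7 + (-1/3) * xJ6)).resolve_left hs
  have zAi7 : ai7 = 0 := (mul_eq_zero.1 (show s * ai7 = 0 by
    linear_combination (5/12) * yI5 + (-1/12) * xI4 + (-1/3) * xJ7 + (1/3) * yJ6)).resolve_left hs
  have zAi4 : ai4 = 0 := (mul_eq_zero.1 (show s * ai4 = 0 by
    linear_combination (-5/12) * yI6 + (1/12) * xI7 + (1/3) * yJ5 + (-1/3) * xJ4)).resolve_left hs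
  have zAi5 : ai5 = 0 := (mul_eq_zero.1 (show s * ai5 = 0 by
    linear_combination (-5/12) * yI7 + (-1/12) * xI6 + (-1/3) * xJ5 + (-1/3) * yJ4)).resolve_left
    hs
  have zAi3 : ai3 = 0 := (mul_eq_zero.1 (show s * ai3 = 0 by
    linear_combination (-2) * xJ3 + (-2) * xL5)).resolve_left hs
  have zBi4 : bi4 = 0 := (mul_eq_zero.1 (show s * bi4 = 0 by
    linear_combination (-1/3) * xJ5 + (5/12) * xI6 + (1/12) * yI7 + (-1/3) * yJ4)).resolve_left hs
  have zBi5 : bi5 = 0 := (mul_eq_zero.1 (show s * bi5 = 0 by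
    linear_combination (-1/3) * yJ5 + (5/12) * xI7 + (-1/12) * yI6 + (1/3) * xJ4)).resolve_left hs
  have zBi6 : bi6 = 0 := (mul_eq_zero.1 (show s * bi6 = 0 by
    linear_combination (1/3) * xJ7 + (-5/12) * xI4 + (1/12) * yI5 + (-1/3) * yJ6)).resolve_left hs
  have zBi7 : bi7 = 0 := (mul_eq_zero.1 (show s * bi7 = 0 by
    linear_combination (-1/3) * yJ7 + (-5/12) * xI5 + (-1/12) * yI4 + (-1/3) * xJ6)).resolve_left
    hs
  have zBi3 : bi3 = 0 := (mul_eq_zero.1 (show s * bi3 = 0 by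
    linear_combination (-2) * yL5 + (-2) * yJ3)).resolve_left hs
  have zBl5 : bl5 = 0 := (mul_eq_zero.1 (show r * bl5 = 0 by
    linear_combination 1 * xJ4 + (1/2) * yI6 + (7/4) * s * zAi4 + 1 * r * zBj3 + (1/4) * s *
    zBi5)).resolve_left hr
  have zAl5 : al5 = 0 := (mul_eq_zero.1 (show r * al5 = 0 by
    linear_combination (-1) * yJ4 + (1/2) * xI6 + 1 * r * zAj3 + (-7/4) * s * zBi4 + (1/4) * s *
    zAi5)).resolve_left hr
  have zBl7 : bl7 = 0 := (mul_eq_zero.1 (show r * bl7 = 0 by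
    linear_combination (-1) * xJ6 + (1/2) * yI4 + (-7/4) * s * zAi6 + (-1/2) * r * zAi3 + (1/4) * s * zBi7)).resolve_left hr
  have zAl7 : al7 = 0 := (mul_eq_zero.1 (show r * al7 = 0 by
    linear_combination 1 * yJ6 + (1/2) * xI4 + (7/4) * s * zBi6 + (1/4) * s * zAi7 + (1/2) * r * zBi3)).resolve_left hr
  have pAj4 : aj4 + bj5 = 0 := (mul_eq_zero.1 (show s * (aj4 + bj5) = 0 by
    linear_combination 1 * xI4 + (1/2) * s * zAi7 + (3/2) * s * zBi6 + 1 * r *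
    zBi3)).resolve_left hs
  have qAj4 : aj4 - bj5 = 0 := (mul_eq_zero.1 (show r * (aj4 - bj5) = 0 by
    linear_combination (-1/2) * yJ3 + (-1/2) * r * zAi7 + (-1/2) * s * zBi3 +
    (-1/2) * r * zBi6)).resolve_left hr
  have zAj4 : aj4 = 0 := by linarith
  have zBj5 : bj5 = 0 := by linarith
  have pAj5 : aj5 - bj4 = 0 := (mul_eq_zero.1 (show s * (aj5 - bj4) = 0 by
    linear_combination (-1) * yI4 + (3/2) * s * zAi6 + 1 * r * zAi3 + (-1/2) *
    s * zBi7)).resolve_left hs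
  have qAj5 : aj5 + bj4 = 0 := (mul_eq_zero.1 (show r * (aj5 + bj4) = 0 by
    linear_combination (1/2) * xJ3 + (1/2) * s * zAi3 + (1/2) * r * zAi6 + (-1/2) * r * zBi7)).resolve_left hr
  have zAj5 : aj5 = 0 := by linarith
  have zBj4 : bj4 = 0 := by linarith
  have pAj6 : aj6 - bj7 = 0 := (mul_eq_zero.1 (show s * (aj6 - bj7) = 0 by
    linear_combination 1 * xI6 + (1/2) * s * zAi5 + (-3/2) * s * zBi4)).resolve_left hs
  have qAj6 : aj6 + bj7 = 0 := (mul_eq_zero.1 (show r * (aj6 + bj7) = 0 by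
    linear_combination (-1) * xL6 + (1/2) * s * zAj3 + 1 * r * zBi4)).resolve_left hr
  have zAj6 : aj6 = 0 := by linarith
  have zBj7 : bj7 = 0 := by linarith
  have pAj7 : aj7 + bj6 = 0 := (mul_eq_zero.1 (show s * (aj7 + bj6) = 0 by
    linear_combination 1 * yI6 + (3/2) * s * zAi4 + (1/2) * s * zBi5)).resolve_left hs
  have qAj7 : aj7 - bj6 = 0 := (mul_eq_zero.1 (show r * (aj7 - bj6) = 0 by
    linear_combination 1 * yL6 + 1 * r * zAi4 + (-1/2) * s * zBj3)).resolve_left hr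
  have zAj7 : aj7 = 0 := by linarith
  have zBj6 : bj6 = 0 := by linarith
  constructor
  · apply Subtype.ext
    apply LinearMap.ext
    intro x
    rw [hA, zAi3, zAi4, zAi5, zAi6, zAi7, zAj3, zAj4, zAj5, zAj6, zAj7, zAl5, zAl7]
    apply ext_coord <;> simp
  · apply Subtype.ext
    apply LinearMap.ext
    intro x
    rw [hB, zBi3, zBi4, zBi5, zBi6, zBi7, zBj3, zBj4, zBj5, zBj6, zBj7, zBl5, zBl7]
    apply ext_coord <;> simp


/-! ### The positive definite invariant form -/

/-- The invariant inner product `-tr(AB)` of the Lie algebra of derivations of the octonions. -/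
noncomputable def traceForm (A B : CompactG2) : ℝ := -LinearMap.trace ℝ Octonion (A.1 * B.1)

section traceForm

variable (A B C : CompactG2) (r : ℝ)

theorem traceForm_comm : traceForm A B = traceForm B A := by
  rw [traceForm, LinearMap.trace_mul_comm, traceForm]

theorem traceForm_add_left : traceForm (A + B) C = traceForm A C + traceForm B C := by
  change -LinearMap.trace ℝ Octonion ((A.1 + B.1) * C.1) = _
  rw [add_mul, map_add, neg_add, traceForm, traceForm]

theorem traceForm_smul_left : traceForm (r • A) C = r * traceForm A C := by
  change -LinearMap.trace ℝ Octonion ((r • A.1) * C.1) = _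
  rw [smul_mul_assoc, map_smul, smul_eq_mul, traceForm, mul_neg]

theorem traceForm_sub_left : traceForm (A - B) C = traceForm A C - traceForm B C := by
  change -LinearMap.trace ℝ Octonion ((A.1 - B.1) * C.1) = _
  rw [sub_mul, map_sub, traceForm, traceForm]
  ring

theorem traceForm_smul_right : traceForm C (r • A) = r * traceForm C A := by
  rw [traceForm_comm, traceForm_smul_left, traceForm_comm A]

theorem traceForm_lie : traceForm ⁅A, B⁆ C = traceForm A ⁅B, C⁆ := by
  change -LinearMap.trace ℝ Octonion ((A.1 * B.1 - B.1 * A.1) * C.1)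
    = -LinearMap.trace ℝ Octonion (A.1 * (B.1 * C.1 - C.1 * B.1))
  rw [sub_mul, mul_sub, map_sub, map_sub, mul_assoc, mul_assoc B.1, LinearMap.trace_mul_comm ℝ B.1,
    mul_assoc]

/-- By skewness -⟨A²x, x⟩ = |Ax|², which makes the form positive definite: this is the compactness
of 𝔤₂. -/
theorem traceForm_self : traceForm A A = dot (A.1 uI) (A.1 uI) + dot (A.1 uJ) (A.1 uJ)
    + dot (A.1 uK) (A.1 uK) + dot (A.1 uL) (A.1 uL) + dot (A.1 uIL) (A.1 uIL)
    + dot (A.1 uJL) (A.1 uJL) + dot (A.1 uKL) (A.1 uKL) := by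
  have h := fun x y => der_skew A (A.1 x) y
  have e0 : ((A.1 * A.1) 1).c0 = 0 := by
    rw [Module.End.mul_apply, der_one, map_zero, c0_zero]
  have e1 : ((A.1 * A.1) uI).c1 = dot (A.1 (A.1 uI)) uI := by
    rw [Module.End.mul_apply]; simp [dot, uI]
  have e2 : ((A.1 * A.1) uJ).c2 = dot (A.1 (A.1 uJ)) uJ := by
    rw [Module.End.mul_apply]; simp [dot, uJ]
  have e3 : ((A.1 * A.1) uK).c3 = dot (A.1 (A.1 uK)) uK := by
    rw [Module.End.mul_apply]; simp [dot, uK]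
  have e4 : ((A.1 * A.1) uL).c4 = dot (A.1 (A.1 uL)) uL := by
    rw [Module.End.mul_apply]; simp [dot, uL]
  have e5 : ((A.1 * A.1) uIL).c5 = dot (A.1 (A.1 uIL)) uIL := by
    rw [Module.End.mul_apply]; simp [dot, uIL]
  have e6 : ((A.1 * A.1) uJL).c6 = dot (A.1 (A.1 uJL)) uJL := by
    rw [Module.End.mul_apply]; simp [dot, uJL]
  have e7 : ((A.1 * A.1) uKL).c7 = dot (A.1 (A.1 uKL)) uKL := by
    rw [Module.End.mul_apply]; simp [dot, uKL]
  rw [traceForm, trace_eq, e0, e1, e2, e3, e4, e5, e6, e7]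
  simp only [h]
  ring

theorem traceForm_self_nonneg : 0 ≤ traceForm A A := by
  have h := fun x => dot_self_nonneg (A.1 x)
  rw [traceForm_self]
  linarith [h uI, h uJ, h uK, h uL, h uIL, h uJL, h uKL]

variable {A}

theorem eq_zero_of_traceForm_self (hA : traceForm A A = 0) : A = 0 := by
  have h := fun x => dot_self_nonneg (A.1 x)
  rw [traceForm_self] at hA
  refine der_ext (eq_zero_of_dot_self ?_) (eq_zero_of_dot_self ?_) (eq_zero_of_dot_self ?_) <;>
    linarith [h uI, h uJ, h uK, h uL, h uIL, h uJL, h uKL]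

theorem traceForm_self_pos (hA : A ≠ 0) : 0 < traceForm A A :=
  lt_of_le_of_ne (traceForm_self_nonneg A) fun h => hA (eq_zero_of_traceForm_self h.symm)

/-- ad A is skew for a definite form, so |[A,B]|² = -⟨B, [A,[A,B]]⟩. -/
theorem lie_eq_zero_of_lie_lie_eq_zero (h : ⁅A, ⁅A, B⁆⁆ = 0) : ⁅A, B⁆ = 0 := by
  apply eq_zero_of_traceForm_self
  have e : traceForm B ⁅A, ⁅A, B⁆⁆ = 0 := by
    rw [h, ← zero_smul ℝ B, traceForm_smul_right, zero_mul]
  rw [← lie_skew, ← neg_one_smul ℝ, traceForm_smul_left, traceForm_lie, neg_one_smul, lie_skew, e,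
    mul_zero]

/-- Being skew, ad A has no generalized kernel beyond its kernel, so Engel subalgebras are
centralizers. -/
theorem mem_engel_iff_lie_eq_zero : B ∈ LieSubalgebra.engel ℝ A ↔ ⁅A, B⁆ = 0 := by
  rw [LieSubalgebra.mem_engel_iff]
  constructor
  · rintro ⟨n, hn⟩
    induction n with
    | zero =>
      rw [pow_zero, Module.End.one_apply] at hn
      rw [hn, lie_zero]
    | succ n ih =>
      cases n with
      | zero => simpa using hn
      | succ n =>
        apply ih
        rw [pow_succ', pow_succ', Module.End.mul_apply, Module.End.mul_apply] at hn
        rw [pow_succ', Module.End.mul_apply]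
        exact lie_eq_zero_of_lie_lie_eq_zero (B := ((LieAlgebra.ad ℝ CompactG2 A) ^ n) B) hn
  · intro h
    exact ⟨1, by simpa using h⟩

end traceForm

/-! ### The rank of 𝔤₂ -/

theorem torusDer_add_smul (a b a' b' r : ℝ) :
    torusDer (a + r * a') (b + r * b') = torusDer a b + r • torusDer a' b' := by
  apply Subtype.ext
  apply LinearMap.ext
  intro x
  change _ = (torusDer a b).1 x + r • (torusDer a' b').1 x
  simp only [torusDer_apply]
  apply ext_coord <;> simp <;> ring

theorem lie_torusDer (a b a' b' : ℝ) : ⁅torusDer a b, torusDer a' b'⁆ = 0 := by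
  apply Subtype.ext
  apply LinearMap.ext
  intro x
  rw [lie_val_apply]
  simp only [torusDer_apply]
  apply ext_coord <;> simp <;> ring

/-- The elements of the standard maximal torus. -/
noncomputable def torusMap : ℝ × ℝ →ₗ[ℝ] CompactG2 where
  toFun p := torusDer p.1 p.2
  map_add' p q := by simpa using torusDer_add_smul p.1 p.2 q.1 q.2 1
  map_smul' r p := by
    have h0 : torusDer 0 0 = 0 := by
      have := torusDer_add_smul 0 0 0 0 1
      simpa using this
    have := torusDer_add_smul 0 0 p.1 p.2 r
    simpa [h0] using this

theorem torusMap_apply (p : ℝ × ℝ) : torusMap p = torusDer p.1 p.2 := rfl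

theorem torusMap_injective : Function.Injective torusMap := by
  intro p q h
  have h1 := congrArg (fun D : CompactG2 => (D.1 uJ).c3) h
  have h2 := congrArg (fun D : CompactG2 => (D.1 uL).c5) h
  simp only [torusMap_apply, torusDer_apply, uJ, uL, c3_mk, c5_mk, c2_mk, c4_mk, mul_one] at h1 h2
  exact Prod.ext h1 h2

/-- The weights 1, 2, -3 of `torusDer 1 2` give root values ±1 (twice), ±2, ±3, ±4, ±5. None is
zero, so the element is regular and its centralizer is the torus. -/
theorem eq_torusDer_of_lie_eq_zero {D : CompactG2} (h : ⁅torusDer 1 2, D⁆ = 0) :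
    D = torusDer (D.1 uJ).c3 (D.1 uL).c5 := by
  have e : ∀ x, (torusDer 1 2).1 (D.1 x) - D.1 ((torusDer 1 2).1 x) = 0 := fun x =>
    congrArg (fun D : CompactG2 => D.1 x) h
  have hD := der_apply_coord D
  simp only [torusDer_apply] at e
  have I2 := congrArg c2 (e uI)
  have I3 := congrArg c3 (e uI)
  have I4 := congrArg c4 (e uI)
  have I5 := congrArg c5 (e uI)
  have I6 := congrArg c6 (e uI)
  have I7 := congrArg c7 (e uI)
  have J4 := congrArg c4 (e uJ)
  have J5 := congrArg c5 (e uJ)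
  have J6 := congrArg c6 (e uJ)
  have J7 := congrArg c7 (e uJ)
  have L6 := congrArg c6 (e uL)
  have L7 := congrArg c7 (e uL)
  generalize D.1 uI = a at hD
  generalize D.1 uJ = b at hD ⊢
  generalize D.1 uL = c at hD ⊢
  simp [hD, uI, uJ, uL] at I2 I3 I4 I5 I6 I7 J4 J5 J6 J7 L6 L7
  apply Subtype.ext
  apply LinearMap.ext
  intro x
  rw [hD, torusDer_apply]
  have I6' : a.c7 = 0 := I6.resolve_left (by norm_num)
  have I7' : a.c6 = 0 := I7.resolve_left (by norm_num)
  have J4' : b.c5 = 0 := by linarith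
  have J5' : b.c4 = 0 := by linarith
  have J6' : b.c7 = 0 := by linarith
  have J7' : b.c6 = 0 := by linarith
  have L6' : c.c7 = 0 := by linarith
  have L7' : c.c6 = 0 := by linarith
  rw [I2, I3, I4, I5, I6', I7', J4', J5', J6', J7', L6', L7']
  apply ext_coord <;> simp

theorem finrank_engel_torusDer : Module.finrank ℝ (LieSubalgebra.engel ℝ (torusDer 1 2)) ≤ 2 := by
  have hle : (LieSubalgebra.engel ℝ (torusDer 1 2)).toSubmodule ≤ LinearMap.range torusMap := by
    intro D hD
    have hD' : D ∈ LieSubalgebra.engel ℝ (torusDer 1 2) := hD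
    rw [mem_engel_iff_lie_eq_zero] at hD'
    exact ⟨((D.1 uJ).c3, (D.1 uL).c5), (eq_torusDer_of_lie_eq_zero hD').symm⟩
  refine (Submodule.finrank_mono hle).trans ((LinearMap.finrank_range_le _).trans ?_)
  simp

/-- D lies in a conjugate of the two-dimensional torus, all of which commutes with D. -/
theorem two_le_finrank_engel (D : CompactG2) :
    2 ≤ Module.finrank ℝ (LieSubalgebra.engel ℝ D) := by
  obtain ⟨v, v1, vv, hv⟩ := exists_unit_der_eq_zero D
  obtain ⟨Φ, h, a, b, -, hD⟩ := exists_conj_eq_torusDer v1 vv hv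
  have hD' : conjEquiv h (torusDer a b) = D := by rw [← hD, LieEquiv.apply_symm_apply]
  let f : ℝ × ℝ →ₗ[ℝ] CompactG2 := (conjEquiv h).toLinearEquiv.toLinearMap ∘ₗ torusMap
  have hf : Function.Injective f := (conjEquiv h).injective.comp torusMap_injective
  have hle : LinearMap.range f ≤ (LieSubalgebra.engel ℝ D).toSubmodule := by
    rintro _ ⟨p, rfl⟩
    change _ ∈ LieSubalgebra.engel ℝ D
    rw [mem_engel_iff_lie_eq_zero, ← hD']
    change ⁅conjEquiv h (torusDer a b), conjEquiv h (torusDer p.1 p.2)⁆ = 0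
    rw [← LieEquiv.map_lie, lie_torusDer, map_zero]
  have := Submodule.finrank_mono hle
  rw [LinearMap.finrank_range_of_inj hf, Module.finrank_prod, Module.finrank_self] at this
  exact this

theorem rank_compactG2 : LieAlgebra.rank ℝ CompactG2 = 2 := by
  apply le_antisymm
  · exact (LieAlgebra.rank_le_finrank_engel ℝ (torusDer 1 2)).trans finrank_engel_torusDer
  · obtain ⟨x, hx⟩ := LieAlgebra.exists_isRegular ℝ CompactG2
    rw [LieAlgebra.isRegular_iff_finrank_engel_eq_rank] at hx
    exact hx ▸ two_le_finrank_engel x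

theorem rank_complex : LieAlgebra.rank ℂ (ℂ ⊗[ℝ] CompactG2) = 2 := by
  rw [LieAlgebra.rank_baseChange, rank_compactG2]

end Octonion

/-! ### Real and imaginary parts in the complexification -/

section ofReIm

variable {M : Type*} [AddCommGroup M] [Module ℝ M]

/-- The element `A + iB` of the complexification. -/
noncomputable def ofReIm (A B : M) : ℂ ⊗[ℝ] M := (1 : ℂ) ⊗ₜ[ℝ] A + Complex.I ⊗ₜ[ℝ] B

theorem ofReIm_add (A B A' B' : M) :
    ofReIm A B + ofReIm A' B' = ofReIm (A + A') (B + B') := by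
  simp only [ofReIm, TensorProduct.tmul_add]
  abel

theorem smul_ofReIm (c : ℂ) (A B : M) :
    c • ofReIm A B = ofReIm (c.re • A - c.im • B) (c.re • B + c.im • A) := by
  have hc : ∀ D : M, c ⊗ₜ[ℝ] D = (1 : ℂ) ⊗ₜ[ℝ] (c.re • D) + Complex.I ⊗ₜ[ℝ] (c.im • D) := by
    intro D
    rw [← TensorProduct.smul_tmul, ← TensorProduct.smul_tmul, ← TensorProduct.add_tmul]
    congr 1
    apply Complex.ext <;> simp
  have hc' : ∀ D : M, (c * Complex.I) ⊗ₜ[ℝ] D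
      = Complex.I ⊗ₜ[ℝ] (c.re • D) - (1 : ℂ) ⊗ₜ[ℝ] (c.im • D) := by
    intro D
    rw [← TensorProduct.smul_tmul, ← TensorProduct.smul_tmul, ← TensorProduct.sub_tmul]
    congr 1
    apply Complex.ext <;> simp
  rw [ofReIm, smul_add, TensorProduct.smul_tmul', TensorProduct.smul_tmul', smul_eq_mul, mul_one,
    smul_eq_mul, hc, hc', ofReIm, TensorProduct.tmul_add, TensorProduct.tmul_sub]
  abel

theorem ofReIm_inj {A B A' B' : M} (h : ofReIm A B = ofReIm A' B') : A = A' ∧ B = B' := by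
  have h1 := congrArg (fun z => TensorProduct.lid ℝ M (Complex.reLm.rTensor M z)) h
  have h2 := congrArg (fun z => TensorProduct.lid ℝ M (Complex.imLm.rTensor M z)) h
  simp [ofReIm] at h1 h2
  exact ⟨h1, h2⟩

theorem exists_ofReIm_of_mem_baseChange {p : Submodule ℝ M} {z : ℂ ⊗[ℝ] M}
    (hz : z ∈ p.baseChange ℂ) : ∃ A ∈ p, ∃ B ∈ p, z = ofReIm A B := by
  rw [Submodule.baseChange_eq_span] at hz
  induction hz using Submodule.span_induction with
  | zero => exact ⟨0, p.zero_mem, 0, p.zero_mem, by simp [ofReIm]⟩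
  | add u v _ _ hu hv =>
    obtain ⟨A, hA, B, hB, rfl⟩ := hu
    obtain ⟨A', hA', B', hB', rfl⟩ := hv
    exact ⟨_, p.add_mem hA hA', _, p.add_mem hB hB', ofReIm_add A B A' B'⟩
  | smul c u _ hu =>
    obtain ⟨A, hA, B, hB, rfl⟩ := hu
    exact ⟨_, p.sub_mem (p.smul_mem _ hA) (p.smul_mem _ hB), _,
      p.add_mem (p.smul_mem _ hB) (p.smul_mem _ hA), smul_ofReIm c A B⟩
  | mem u hu =>
    obtain ⟨A, hA, rfl⟩ := hu
    exact ⟨A, hA, 0, p.zero_mem, by simp [ofReIm]⟩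

theorem ofReIm_zero_right (A : M) : ofReIm A 0 = (1 : ℂ) ⊗ₜ[ℝ] A := by
  rw [ofReIm, TensorProduct.tmul_zero, add_zero]

variable {L : Type*} [LieRing L] [LieAlgebra ℝ L]

theorem ofReIm_lie (P Q A B : L) :
    ⁅ofReIm P Q, ofReIm A B⁆ = ofReIm (⁅P, A⁆ - ⁅Q, B⁆) (⁅P, B⁆ + ⁅Q, A⁆) := by
  simp only [ofReIm, add_lie, lie_add, LieAlgebra.ExtendScalars.bracket_tmul, one_mul, mul_one,
    Complex.I_mul_I, TensorProduct.neg_tmul, TensorProduct.tmul_add, TensorProduct.tmul_sub]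
  abel

theorem lie_ofReIm_of_lie_eq {H A B : L} (hA : ⁅H, A⁆ = B) (hB : ⁅H, B⁆ = -A) :
    ⁅ofReIm 0 ((2 : ℝ) • H), ofReIm A B⁆ = (2 : ℂ) • ofReIm A B := by
  rw [ofReIm_lie, smul_ofReIm, smul_lie, smul_lie, hA, hB]
  simp

theorem ad_mul_sub_mul_eq {h e : ℂ ⊗[ℝ] L} (he : ⁅h, e⁆ = (2 : ℂ) • e) :
    LieAlgebra.ad ℂ (ℂ ⊗[ℝ] L) h * LieAlgebra.ad ℂ (ℂ ⊗[ℝ] L) e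
      - LieAlgebra.ad ℂ (ℂ ⊗[ℝ] L) e * LieAlgebra.ad ℂ (ℂ ⊗[ℝ] L) h
      = (2 : ℂ) • LieAlgebra.ad ℂ (ℂ ⊗[ℝ] L) e := by
  have := LieHom.map_lie (LieAlgebra.ad ℂ (ℂ ⊗[ℝ] L)) h e
  rw [he, map_smul] at this
  exact this.symm

end ofReIm

/-! ### From a principal subalgebra to an 𝔰𝔬(3) triple -/

namespace Octonion

/-- Real elements commuting with H stay independent over ℂ and lie in ker ad(2iH), whose dimension
is bounded by that of ker ad e. -/
theorem hasSmallCentralizer_of_finrank_ker_ad {H : CompactG2} {e : ℂ ⊗[ℝ] CompactG2}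
    (he : ⁅ofReIm 0 ((2 : ℝ) • H), e⁆ = (2 : ℂ) • e)
    (hfin : Module.finrank ℂ (LinearMap.ker (LieAlgebra.ad ℂ (ℂ ⊗[ℝ] CompactG2) e)) ≤ 2) :
    HasSmallCentralizer H := by
  intro A B C hA hB hC hlin
  have hle := (finrank_ker_le_of_lie_eq_two_nsmul (ad_mul_sub_mul_eq he)).trans hfin
  have hlin' := Module.Flat.linearIndependent_one_tmul (S := ℂ) hlin
  have hspan : Submodule.span ℂ (Set.range fun i => (1 : ℂ) ⊗ₜ[ℝ] (![A, B, C] i)) ≤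
      LinearMap.ker (LieAlgebra.ad ℂ (ℂ ⊗[ℝ] CompactG2) (ofReIm 0 ((2 : ℝ) • H))) := by
    rw [Submodule.span_le]
    rintro _ ⟨i, rfl⟩
    have hi : ⁅H, ![A, B, C] i⁆ = 0 := by fin_cases i <;> assumption
    change ⁅ofReIm 0 ((2 : ℝ) • H), (1 : ℂ) ⊗ₜ[ℝ] (![A, B, C] i)⁆ = 0
    rw [← ofReIm_zero_right, ofReIm_lie, smul_lie, smul_lie, hi]
    simp [ofReIm]
  have := Submodule.finrank_mono hspan
  rw [finrank_span_eq_card hlin', Fintype.card_fin] at this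
  omega

section orthogonal

variable {A B C : CompactG2}

theorem traceForm_combination (a b c : ℝ) (D : CompactG2) :
    traceForm (a • A + b • B + c • C) D
      = a * traceForm A D + b * traceForm B D + c * traceForm C D := by
  rw [traceForm_add_left, traceForm_add_left, traceForm_smul_left, traceForm_smul_left,
    traceForm_smul_left]

theorem linearIndependent_of_orthogonal (hA : A ≠ 0) (hB : B ≠ 0) (hC : C ≠ 0)
    (hAB : traceForm A B = 0) (hAC : traceForm A C = 0) (hBC : traceForm B C = 0) :
    LinearIndependent ℝ ![A, B, C] := by
  rw [Fintype.linearIndependent_iff]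
  intro g hg
  rw [Fin.sum_univ_three] at hg
  change g 0 • A + g 1 • B + g 2 • C = 0 at hg
  have h0 : ∀ D : CompactG2, traceForm 0 D = 0 := fun D => by
    rw [← zero_smul ℝ D, traceForm_smul_left, zero_mul]
  have h := fun D => traceForm_combination (A := A) (B := B) (C := C) (g 0) (g 1) (g 2) D
  rw [hg] at h
  have hA' := h A
  have hB' := h B
  have hC' := h C
  rw [h0, traceForm_comm B, traceForm_comm C, hAB, hAC, mul_zero, mul_zero, add_zero, add_zero]
    at hA'
  rw [h0, traceForm_comm C, hAB, hBC, mul_zero, mul_zero, zero_add, add_zero] at hB'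
  rw [h0, hAC, hBC, mul_zero, mul_zero, zero_add, zero_add] at hC'
  intro i
  fin_cases i
  · exact (mul_eq_zero.1 hA'.symm).resolve_right (traceForm_self_pos hA).ne'
  · exact (mul_eq_zero.1 hB'.symm).resolve_right (traceForm_self_pos hB).ne'
  · exact (mul_eq_zero.1 hC'.symm).resolve_right (traceForm_self_pos hC).ne'

theorem eq_zero_of_mem_span_of_orthogonal {D : CompactG2}
    (hD : D ∈ Submodule.span ℝ {A, B, C}) (h1 : traceForm A D = 0) (h2 : traceForm B D = 0)
    (h3 : traceForm C D = 0) : D = 0 := by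
  obtain ⟨a, b, c, rfl⟩ := Submodule.mem_span_triple.1 hD
  apply eq_zero_of_traceForm_self
  rw [traceForm_combination, h1, h2, h3]
  ring

end orthogonal

theorem _root_.IsPrincipalTDS.exists_so3Triple {s : LieSubalgebra ℝ CompactG2}
    (hs : IsPrincipalTDS s) : ∃ H X Y : CompactG2, IsSo3Triple H X Y ∧ HasSmallCentralizer H ∧
      s.toSubmodule = Submodule.span ℝ {H, X, Y} := by
  obtain ⟨h, e, f, t, ⟨-, hker⟩, hspan⟩ := hs.isPrincipal
  rw [rank_complex] at hker
  have hh : h ∈ s.toSubmodule.baseChange ℂ := by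
    change h ∈ (complexification s).toSubmodule
    rw [hspan]
    exact Submodule.subset_span (by simp)
  have he : e ∈ s.toSubmodule.baseChange ℂ := by
    change e ∈ (complexification s).toSubmodule
    rw [hspan]
    exact Submodule.subset_span (by simp)
  have he0 : e ≠ 0 := by
    rintro rfl
    exact t.h_ne_zero (by rw [← t.lie_e_f, zero_lie])
  have hhe : ⁅h, e⁆ = (2 : ℂ) • e := by
    rw [t.lie_h_e_nsmul, ← Nat.cast_smul_eq_nsmul ℂ]
    norm_num
  obtain ⟨P, hP, Q, hQ, rfl⟩ := exists_ofReIm_of_mem_baseChange hh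
  obtain ⟨A, hA, B, hB, rfl⟩ := exists_ofReIm_of_mem_baseChange he
  rw [ofReIm_lie, smul_ofReIm] at hhe
  obtain ⟨h1, h2⟩ := ofReIm_inj hhe
  simp only [Complex.re_ofNat, Complex.im_ofNat, zero_smul, sub_zero, add_zero] at h1 h2
  set C : CompactG2 := ⁅A, B⁆ with hCdef
  have hz : ∀ D : CompactG2, traceForm D 0 = 0 := fun D => by
    rw [← zero_smul ℝ D, traceForm_smul_right, zero_mul]
  have hBA : ⁅B, A⁆ = (-1 : ℝ) • C := by rw [neg_one_smul, hCdef, lie_skew]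
  -- Write h = P + iQ, e = A + iB and C = [A,B]. Pairing the two parts of [h,e] = 2e with A and B
  -- gives ⟨Q,C⟩ = 2|A|² = 2|B|² and ⟨P,C⟩ = 2⟨A,B⟩ = -2⟨A,B⟩. So A and B are orthogonal of equal
  -- length and C ≠ 0.
  have e1 := congrArg (fun D => traceForm D A) h1
  have e2 := congrArg (fun D => traceForm D B) h1
  have e3 := congrArg (fun D => traceForm D A) h2
  have e4 := congrArg (fun D => traceForm D B) h2
  simp only [traceForm_sub_left, traceForm_add_left, traceForm_smul_left, traceForm_lie, lie_self,
    hz, hBA, ← hCdef, traceForm_smul_right] at e1 e2 e3 e4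
  rw [traceForm_comm B A] at e3
  have hAB : traceForm A B = 0 := by linarith
  have hnn : traceForm A A = traceForm B B := by linarith
  have hA0 : A ≠ 0 := by
    rintro rfl
    rw [hz] at hnn
    rw [eq_zero_of_traceForm_self hnn.symm] at he0
    exact he0 (by simp [ofReIm])
  have hn := traceForm_self_pos hA0
  have hB0 : B ≠ 0 := by
    rintro rfl
    rw [hz] at hnn
    exact hn.ne' hnn
  have hC0 : C ≠ 0 := by
    intro h0
    rw [h0, hz] at e4
    linarith
  have hAC : traceForm A C = 0 := by rw [hCdef, ← traceForm_lie, lie_self, ← traceForm_comm, hz]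
  have hBC : traceForm B C = 0 := by
    rw [traceForm_comm, hCdef, traceForm_lie, lie_self, hz]
  have hlin := linearIndependent_of_orthogonal hA0 hB0 hC0 hAB hAC hBC
  have hC : C ∈ s := s.lie_mem hA hB
  have hsp : Submodule.span ℝ {A, B, C} = s.toSubmodule := by
    apply Submodule.eq_of_le_of_finrank_eq
    · rw [Submodule.span_le]
      rintro x (rfl | rfl | rfl)
      exacts [hA, hB, hC]
    · have := finrank_span_eq_card hlin
      rw [Fintype.card_fin] at this
      rw [show ({A, B, C} : Set CompactG2) = Set.range ![A, B, C] by
        ext; simp [eq_comm]; tauto, this]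
      exact hs.finrank_eq.symm
  set n := traceForm A A with hndef
  set k := traceForm C C / n with hkdef
  have hk : 0 < k := div_pos (traceForm_self_pos hC0) hn
  have hkn : k * n = traceForm C C := div_mul_cancel₀ _ hn.ne'
  -- A, B, C form an orthogonal basis of the subalgebra. By invariance [C,A] is orthogonal to A and
  -- C, and ⟨[C,A], B⟩ = |C|² = k|B|².
  have hCA : ⁅C, A⁆ = k • B := by
    rw [← sub_eq_zero]
    apply eq_zero_of_mem_span_of_orthogonal (A := A) (B := B) (C := C)
    · rw [hsp]
      exact s.toSubmodule.sub_mem (s.lie_mem hC hA) (s.toSubmodule.smul_mem k hB)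
    · rw [traceForm_comm, traceForm_sub_left, traceForm_lie, lie_self, hz, traceForm_smul_left,
        traceForm_comm, hAB]
      ring
    · rw [traceForm_comm, traceForm_sub_left, traceForm_lie, traceForm_smul_left, ← hCdef, ← hnn,
        hkn, sub_self]
    · rw [traceForm_comm, traceForm_sub_left, traceForm_comm, ← traceForm_lie, lie_self,
        traceForm_comm, hz, traceForm_smul_left, hBC]
      ring
  have hCB : ⁅C, B⁆ = -(k • A) := by
    rw [← sub_eq_zero, sub_neg_eq_add]
    apply eq_zero_of_mem_span_of_orthogonal (A := A) (B := B) (C := C)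
    · rw [hsp]
      exact s.toSubmodule.add_mem (s.lie_mem hC hB) (s.toSubmodule.smul_mem k hA)
    · rw [traceForm_comm, traceForm_add_left, traceForm_lie, hBA, traceForm_smul_right,
        traceForm_smul_left, ← hndef, hkn]
      ring
    · rw [traceForm_comm, traceForm_add_left, traceForm_lie, lie_self, hz, traceForm_smul_left,
        hAB]
      ring
    · rw [traceForm_comm, traceForm_add_left, traceForm_comm, ← traceForm_lie, lie_self,
        traceForm_comm, hz, traceForm_smul_left, hAC]
      ring
  have hsk : √k * √k = k := Real.mul_self_sqrt hk.le
  have hsk0 : √k ≠ 0 := (Real.sqrt_pos.2 hk).ne'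
  have hHA : ⁅k⁻¹ • C, A⁆ = B := by rw [smul_lie, hCA, smul_smul, inv_mul_cancel₀ hk.ne', one_smul]
  have hHB : ⁅k⁻¹ • C, B⁆ = -A := by
    rw [smul_lie, hCB, smul_neg, smul_smul, inv_mul_cancel₀ hk.ne', one_smul]
  -- The factor 1/√k on A and B makes their bracket C/k. The element e = A + iB itself needs no
  -- rescaling, as it is already an eigenvector of ad(2iH) for the eigenvalue 2.
  refine ⟨k⁻¹ • C, (√k)⁻¹ • A, (√k)⁻¹ • B, ⟨?_, ?_, ?_⟩, ?_, ?_⟩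
  · rw [lie_smul, hHA]
  · rw [lie_smul, smul_lie, ← hCdef, smul_smul, ← mul_inv, hsk]
  · rw [← lie_skew, lie_smul, hHB, smul_neg, neg_neg]
  · exact hasSmallCentralizer_of_finrank_ker_ad (lie_ofReIm_of_lie_eq hHA hHB) hker.le
  · rw [← hsp]
    apply le_antisymm <;> rw [Submodule.span_le]
    · have hm : ∀ D ∈ ({k⁻¹ • C, (√k)⁻¹ • A, (√k)⁻¹ • B} : Set CompactG2),
          D ∈ Submodule.span ℝ {k⁻¹ • C, (√k)⁻¹ • A, (√k)⁻¹ • B} :=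
        fun D hD => Submodule.subset_span hD
      rintro x (rfl | rfl | rfl)
      · have := Submodule.smul_mem _ (√k) (hm ((√k)⁻¹ • x) (by simp))
        rwa [smul_smul, mul_inv_cancel₀ hsk0, one_smul] at this
      · have := Submodule.smul_mem _ (√k) (hm ((√k)⁻¹ • x) (by simp))
        rwa [smul_smul, mul_inv_cancel₀ hsk0, one_smul] at this
      · have := Submodule.smul_mem _ k (hm (k⁻¹ • C) (by simp))
        rwa [smul_smul, mul_inv_cancel₀ hk.ne', one_smul] at this
    · rintro x (rfl | rfl | rfl) <;> exact Submodule.smul_mem _ _ (Submodule.subset_span (by simp))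

/-- Subalgebras spanned by `𝔰𝔬₃`-triples with small centralizer are conjugate. -/
theorem exists_map_eq_of_so3Triple {s s' : LieSubalgebra ℝ CompactG2} {H X Y H' X' Y' : CompactG2}
    (t : IsSo3Triple H X Y) (hH : HasSmallCentralizer H)
    (hs : s.toSubmodule = Submodule.span ℝ {H, X, Y}) (t' : IsSo3Triple H' X' Y')
    (hH' : HasSmallCentralizer H') (hs' : s'.toSubmodule = Submodule.span ℝ {H', X', Y'}) :
    ∃ φ : CompactG2 ≃ₗ⁅ℝ⁆ CompactG2, s.map φ.toLieHom = s' := by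
  obtain ⟨φ, h1, h2⟩ := hH.exists_conj_eq_standard t
  obtain ⟨φ', h1', h2'⟩ := hH'.exists_conj_eq_standard t'
  have e1 : (φ.trans φ'.symm) H = H' := by
    rw [LieEquiv.trans_apply, h1, ← h1', LieEquiv.symm_apply_apply]
  have e2 : (φ.trans φ'.symm) X = X' := by
    rw [LieEquiv.trans_apply, h2, ← h2', LieEquiv.symm_apply_apply]
  refine ⟨φ.trans φ'.symm, ?_⟩
  generalize φ.trans φ'.symm = ψ at e1 e2
  -- The third generator follows from Y = [H,X].
  have e3 : ψ Y = Y' := by rw [← t.lie_H_X, LieEquiv.map_lie, e1, e2, t'.lie_H_X]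
  rw [← LieSubalgebra.toSubmodule_inj, hs']
  change s.toSubmodule.map _ = _
  rw [hs, Submodule.map_span]
  congr 1
  rw [Set.image_insert_eq, Set.image_pair]
  change {ψ H, ψ X, ψ Y} = _
  rw [e1, e2, e3]

end Octonion

/-! ### Subalgebras spanned by 𝔰𝔬(3) triples -/

section so3

theorem Octonion.IsSo3Triple.rotate {L : Type*} [LieRing L] {H X Y : L}
    (t : Octonion.IsSo3Triple H X Y) : Octonion.IsSo3Triple X Y H :=
  ⟨t.lie_X_Y, t.lie_Y_H, t.lie_H_X⟩

variable {L : Type*} [LieRing L] [LieAlgebra ℝ L] {H X Y : L}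

theorem Octonion.IsSo3Triple.lie_combination (t : Octonion.IsSo3Triple H X Y) (a b c : ℝ) :
    ⁅H, a • H + b • X + c • Y⁆ = b • Y - c • X := by
  rw [lie_add, lie_add, lie_smul, lie_smul, lie_smul, lie_self, t.lie_H_X, ← lie_skew H Y,
    t.lie_Y_H, smul_zero, zero_add, smul_neg, sub_eq_add_neg]

/-- A double bracket isolates one coefficient. With its cyclic rotations it shows that a nonzero
ideal contains a generator, and hence all three. -/
theorem Octonion.IsSo3Triple.lie_lie_combination (t : Octonion.IsSo3Triple H X Y) (a b c : ℝ) :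
    ⁅X, ⁅H, a • H + b • X + c • Y⁆⁆ = b • H := by
  rw [t.lie_combination, lie_sub, lie_smul, lie_smul, t.lie_X_Y, lie_self, smul_zero, sub_zero]

/-- The span of an `𝔰𝔬₃`-triple. -/
def Octonion.IsSo3Triple.subalgebra (t : Octonion.IsSo3Triple H X Y) : LieSubalgebra ℝ L where
  toSubmodule := Submodule.span ℝ {H, X, Y}
  lie_mem' := by
    intro u v hu hv
    change u ∈ Submodule.span ℝ {H, X, Y} at hu
    change v ∈ Submodule.span ℝ {H, X, Y} at hv
    change ⁅u, v⁆ ∈ Submodule.span ℝ {H, X, Y}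
    have mH : H ∈ Submodule.span ℝ {H, X, Y} := Submodule.subset_span (by simp)
    have mX : X ∈ Submodule.span ℝ {H, X, Y} := Submodule.subset_span (by simp)
    have mY : Y ∈ Submodule.span ℝ {H, X, Y} := Submodule.subset_span (by simp)
    obtain ⟨a, b, c, rfl⟩ := Submodule.mem_span_triple.1 hu
    obtain ⟨a', b', c', rfl⟩ := Submodule.mem_span_triple.1 hv
    have e1 := t.lie_combination a' b' c'
    have e2 := t.rotate.lie_combination b' c' a'
    have e3 := t.rotate.rotate.lie_combination c' a' b'
    rw [show b' • X + c' • Y + a' • H = a' • H + b' • X + c' • Y by abel] at e2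
    rw [show c' • Y + a' • H + b' • X = a' • H + b' • X + c' • Y by abel] at e3
    rw [add_lie, add_lie, smul_lie, smul_lie, smul_lie, e1, e2, e3]
    refine add_mem (add_mem ?_ ?_) ?_ <;>
      exact Submodule.smul_mem _ _ (sub_mem (Submodule.smul_mem _ _ (by assumption))
        (Submodule.smul_mem _ _ (by assumption)))

theorem Octonion.IsSo3Triple.mem_of_mem (t : Octonion.IsSo3Triple H X Y) {I : LieIdeal ℝ L}
    (hH : H ∈ I) : H ∈ I ∧ X ∈ I ∧ Y ∈ I := by
  refine ⟨hH, ?_, ?_⟩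
  · rw [← t.lie_Y_H]
    exact lie_mem_right ℝ L I Y H hH
  · rw [← t.lie_H_X]
    exact lie_mem_left ℝ L I H X hH

/-- A Lie algebra spanned by an `𝔰𝔬₃`-triple is simple. -/
theorem Octonion.IsSo3Triple.isSimple (t : Octonion.IsSo3Triple H X Y) (hH : H ≠ 0)
    (hspan : ∀ z : L, ∃ a b c : ℝ, z = a • H + b • X + c • Y) : LieAlgebra.IsSimple ℝ L where
  eq_bot_or_eq_top I := by
    rw [or_iff_not_imp_left]
    intro hI
    rw [LieSubmodule.eq_bot_iff] at hI
    push Not at hI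
    obtain ⟨z, hz, hz0⟩ := hI
    have hmem : H ∈ I ∧ X ∈ I ∧ Y ∈ I := by
      obtain ⟨a, b, c, rfl⟩ := hspan z
      have m : ∀ u v : L, ⁅u, ⁅v, a • H + b • X + c • Y⁆⁆ ∈ I := fun u v =>
        lie_mem_right ℝ L I _ _ (lie_mem_right ℝ L I _ _ hz)
      have e1 := t.lie_lie_combination a b c
      have e2 := t.rotate.lie_lie_combination b c a
      have e3 := t.rotate.rotate.lie_lie_combination c a b
      rw [show b • X + c • Y + a • H = a • H + b • X + c • Y by abel] at e2
      rw [show c • Y + a • H + b • X = a • H + b • X + c • Y by abel] at e3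
      have k : ∀ {r : ℝ} {D : L}, r ≠ 0 → r • D ∈ I → D ∈ I := fun {r D} hr h => by
        have := I.smul_mem r⁻¹ h
        rwa [smul_smul, inv_mul_cancel₀ hr, one_smul] at this
      by_cases hb : b = 0
      · by_cases hc : c = 0
        · have ha : a ≠ 0 := by
            rintro rfl
            exact hz0 (by simp [hb, hc])
          obtain ⟨h1, h2, h3⟩ := t.rotate.rotate.mem_of_mem
            (k ha (e3 ▸ m _ _))
          exact ⟨h2, h3, h1⟩
        · obtain ⟨h1, h2, h3⟩ := t.rotate.mem_of_mem (k hc (e2 ▸ m _ _))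
          exact ⟨h3, h1, h2⟩
      · exact t.mem_of_mem (k hb (e1 ▸ m _ _))
    rw [eq_top_iff]
    intro w _
    obtain ⟨a, b, c, rfl⟩ := hspan w
    exact add_mem (add_mem (I.smul_mem a hmem.1) (I.smul_mem b hmem.2.1)) (I.smul_mem c hmem.2.2)
  non_abelian h := hH (by rw [← t.lie_X_Y, h.trivial])

theorem Octonion.IsSo3Triple.isSl2Triple (t : Octonion.IsSo3Triple H X Y) (hH : H ≠ 0) :
    IsSl2Triple (ofReIm 0 ((2 : ℝ) • H)) (ofReIm X Y) (ofReIm (-X) Y) where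
  h_ne_zero h0 := by
    have h0' : ofReIm 0 ((2 : ℝ) • H) = ofReIm 0 0 := by rw [h0]; simp [ofReIm]
    exact hH ((smul_eq_zero.1 (ofReIm_inj h0').2).resolve_left two_ne_zero)
  lie_e_f := by
    rw [ofReIm_lie, lie_neg, lie_neg, lie_self, lie_self, t.lie_X_Y, neg_zero, sub_zero,
      lie_skew, t.lie_X_Y, two_smul]
  lie_h_e_nsmul := by
    have hHY : ⁅H, Y⁆ = -X := by rw [← lie_skew, t.lie_Y_H]
    rw [lie_ofReIm_of_lie_eq t.lie_H_X hHY, ← Nat.cast_smul_eq_nsmul ℂ]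
    norm_num
  lie_h_f_nsmul := by
    have hHY : ⁅H, Y⁆ = -X := by rw [← lie_skew, t.lie_Y_H]
    rw [ofReIm_lie, zero_lie, zero_lie, smul_lie, smul_lie, hHY, lie_neg, t.lie_H_X, two_nsmul, ofReIm_add,
      ← neg_one_smul ℂ (ofReIm _ _), smul_ofReIm]
    simp [two_smul]

theorem span_ofReIm_triple (H X Y : L) :
    (Submodule.span ℝ {H, X, Y}).baseChange ℂ =
      Submodule.span ℂ {ofReIm X Y, ofReIm 0 ((2 : ℝ) • H), ofReIm (-X) Y} := by
  rw [Submodule.baseChange_span, Set.image_insert_eq, Set.image_pair]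
  simp only [TensorProduct.mk_apply, ← ofReIm_zero_right]
  apply le_antisymm <;> rw [Submodule.span_le]
  · have me : ofReIm X Y ∈ Submodule.span ℂ
        {ofReIm X Y, ofReIm 0 ((2 : ℝ) • H), ofReIm (-X) Y} := Submodule.subset_span (by simp)
    have mh : ofReIm 0 ((2 : ℝ) • H) ∈ Submodule.span ℂ
        {ofReIm X Y, ofReIm 0 ((2 : ℝ) • H), ofReIm (-X) Y} := Submodule.subset_span (by simp)
    have mf : ofReIm (-X) Y ∈ Submodule.span ℂ
        {ofReIm X Y, ofReIm 0 ((2 : ℝ) • H), ofReIm (-X) Y} := Submodule.subset_span (by simp)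
    rintro x (rfl | rfl | rfl)
    · convert Submodule.smul_mem _ (-(1 / 2) * Complex.I) mh using 1
      rw [smul_ofReIm]
      simp [smul_smul]
    · convert Submodule.smul_mem _ (1 / 2) (sub_mem me mf) using 1
      rw [sub_eq_add_neg, ← neg_one_smul ℂ (ofReIm (-X) Y), smul_ofReIm, ofReIm_add, smul_ofReIm]
      simp [smul_smul, ← two_smul ℝ X]
    · convert Submodule.smul_mem _ (-(1 / 2) * Complex.I) (add_mem me mf) using 1
      rw [ofReIm_add, smul_ofReIm]
      simp [smul_smul, ← two_smul ℝ Y]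
  · have mem : ∀ A ∈ Submodule.span ℝ {H, X, Y}, ∀ B ∈ Submodule.span ℝ {H, X, Y}, ofReIm A B ∈
        Submodule.span ℂ {ofReIm H 0, ofReIm X 0, ofReIm Y 0} := by
      intro A hA B hB
      have e : Submodule.span ℂ {ofReIm H 0, ofReIm X 0, ofReIm Y 0}
          = (Submodule.span ℝ {H, X, Y}).baseChange ℂ := by
        rw [Submodule.baseChange_span, Set.image_insert_eq, Set.image_pair]
        simp only [TensorProduct.mk_apply, ← ofReIm_zero_right]
      rw [e]
      exact add_mem (Submodule.tmul_mem_baseChange_of_mem _ hA)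
        (Submodule.tmul_mem_baseChange_of_mem _ hB)
    have mH : H ∈ Submodule.span ℝ {H, X, Y} := Submodule.subset_span (by simp)
    have mX : X ∈ Submodule.span ℝ {H, X, Y} := Submodule.subset_span (by simp)
    have mY : Y ∈ Submodule.span ℝ {H, X, Y} := Submodule.subset_span (by simp)
    rintro x (rfl | rfl | rfl)
    · exact mem _ mX _ mY
    · exact mem _ (zero_mem _) _ (Submodule.smul_mem _ _ mH)
    · exact mem _ (neg_mem mX) _ mY

end so3

/-! ### Existence: the standard triple is principal -/

namespace Octonion

theorem isSo3Triple_standard : IsSo3Triple (torusDer 1 2) (mixedDer (√6) (√(5 / 2)))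
    ⁅torusDer 1 2, mixedDer (√6) (√(5 / 2))⁆ := by
  have hs : √6 * √6 = 6 := Real.mul_self_sqrt (by norm_num)
  have hr : √(5 / 2) * √(5 / 2) = 5 / 2 := Real.mul_self_sqrt (by norm_num)
  -- Only the squares of the two constants enter the relations.
  generalize √6 = s at hs
  generalize √(5 / 2) = r at hr
  refine ⟨rfl, ?_, ?_⟩
  · apply Subtype.ext
    apply LinearMap.ext
    intro x
    simp only [lie_val_apply, mixedDer_apply, torusDer_apply]
    apply ext_coord <;> simp
    · ring
    · linear_combination -x.c3 * hs + 2 * x.c3 * hr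
    · linear_combination x.c2 * hs - 2 * x.c2 * hr
    · linear_combination x.c5 / 2 * hs - 2 * x.c5 * hr
    · linear_combination -x.c4 / 2 * hs + 2 * x.c4 * hr
    · linear_combination -x.c7 / 2 * hs
    · linear_combination x.c6 / 2 * hs
  · apply Subtype.ext
    apply LinearMap.ext
    intro x
    simp only [lie_val_apply, mixedDer_apply, torusDer_apply]
    apply ext_coord <;> simp <;> ring

theorem torusDer_ne_zero : torusDer 1 2 ≠ 0 := by
  intro h
  have := congrArg (fun D : CompactG2 => (D.1 uJ).c3) h
  simp [torusDer_apply, uJ] at this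

theorem IsSo3Triple.finrank_subalgebra {H X Y : CompactG2} (t : IsSo3Triple H X Y) (hH : H ≠ 0) :
    Module.finrank ℝ t.subalgebra = 3 := by
  have hX : X ≠ 0 := by
    rintro rfl
    exact hH (by rw [← t.lie_X_Y, zero_lie])
  have hY : Y ≠ 0 := by
    rintro rfl
    exact hH (by rw [← t.lie_X_Y, lie_zero])
  have hz : ∀ D : CompactG2, traceForm D 0 = 0 := fun D => by
    rw [← zero_smul ℝ D, traceForm_smul_right, zero_mul]
  have hlin := linearIndependent_of_orthogonal hH hX hY
    (by rw [traceForm_comm, ← t.lie_X_Y, ← traceForm_lie, lie_self, traceForm_comm, hz])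
    (by rw [← t.lie_X_Y, traceForm_lie, lie_self, hz])
    (by rw [← t.lie_H_X, traceForm_comm, traceForm_lie, lie_self, hz])
  have := finrank_span_eq_card hlin
  rw [Fintype.card_fin] at this
  rw [show Set.range ![H, X, Y] = ({H, X, Y} : Set CompactG2) by
    ext; simp [eq_comm]; tauto] at this
  exact this

theorem IsSo3Triple.isSimple_subalgebra {H X Y : CompactG2} (t : IsSo3Triple H X Y) (hH : H ≠ 0) :
    LieAlgebra.IsSimple ℝ t.subalgebra := by
  have m : ∀ D ∈ ({H, X, Y} : Set CompactG2), D ∈ t.subalgebra := fun D hD =>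
    Submodule.subset_span hD
  have t' : IsSo3Triple (⟨H, m H (by simp)⟩ : t.subalgebra) ⟨X, m X (by simp)⟩
      ⟨Y, m Y (by simp)⟩ :=
    ⟨Subtype.ext t.lie_H_X, Subtype.ext t.lie_X_Y, Subtype.ext t.lie_Y_H⟩
  refine t'.isSimple (fun h => hH (congrArg Subtype.val h)) fun z => ?_
  obtain ⟨a, b, c, h⟩ := Submodule.mem_span_triple.1 (show z.1 ∈ Submodule.span ℝ {H, X, Y} from z.2)
  exact ⟨a, b, c, Subtype.ext h.symm⟩

/-- The two coordinates that separate the centralizer of the principal nilpotent element. -/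
noncomputable def centralizerCoord : CompactG2 →ₗ[ℝ] ℝ × ℝ where
  toFun D := ((D.1 uI).c2, (D.1 uL).c6)
  map_add' _ _ := rfl
  map_smul' _ _ := rfl

theorem finrank_ker_ad_principal {X Y : CompactG2} (hX : X = mixedDer (√6) (√(5 / 2)))
    (hY : Y = ⁅torusDer 1 2, X⁆) :
    Module.finrank ℂ (LinearMap.ker (LieAlgebra.ad ℂ (ℂ ⊗[ℝ] CompactG2) (ofReIm X Y))) ≤ 2 := by
  have h2 : Module.finrank ℂ (ℂ ⊗[ℝ] (ℝ × ℝ)) = 2 := by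
    rw [Module.finrank_baseChange, Module.finrank_prod, Module.finrank_self]
  rw [← h2]
  refine LinearMap.finrank_le_finrank_of_injective
    (f := centralizerCoord.baseChange ℂ ∘ₗ Submodule.subtype _) ?_
  rw [injective_iff_map_eq_zero]
  rintro ⟨z, hz⟩ h0
  have hz' : z ∈ (⊤ : Submodule ℝ CompactG2).baseChange ℂ := by
    rw [Submodule.baseChange_top]; trivial
  obtain ⟨A, -, B, -, rfl⟩ := exists_ofReIm_of_mem_baseChange hz'
  have h0' : ofReIm (centralizerCoord A) (centralizerCoord B) = ofReIm 0 0 := by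
    have e : centralizerCoord.baseChange ℂ (ofReIm A B) = 0 := h0
    rw [ofReIm, map_add, LinearMap.baseChange_tmul, LinearMap.baseChange_tmul] at e
    rw [ofReIm, e]
    simp [ofReIm]
  have hz0 : ⁅ofReIm X Y, ofReIm A B⁆ = ofReIm 0 0 := by
    have e : ⁅ofReIm X Y, ofReIm A B⁆ = 0 := hz
    rw [e]
    simp [ofReIm]
  rw [ofReIm_lie] at hz0
  obtain ⟨e1, e2⟩ := ofReIm_inj hz0
  obtain ⟨f1, f2⟩ := ofReIm_inj h0'
  have c1 : ⁅A, X⁆ = ⁅B, Y⁆ := by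
    rw [← lie_skew, ← lie_skew B, sub_eq_zero.1 e1]
  have c2 : ⁅A, Y⁆ = -⁅B, X⁆ := by
    rw [lie_skew, eq_neg_of_add_eq_zero_left e2, lie_skew]
  obtain ⟨rfl, rfl⟩ := centralizer_mixedDer (Real.sqrt_pos.2 (by norm_num)).ne'
    (Real.sqrt_pos.2 (by norm_num)).ne' hX hY c1 c2 (congrArg Prod.fst f1) (congrArg Prod.fst f2)
    (congrArg Prod.snd f1) (congrArg Prod.snd f2)
  apply Subtype.ext
  simp [ofReIm]

theorem two_le_finrank_ker_ad :
    2 ≤ Module.finrank ℂ (LinearMap.ker (LieAlgebra.ad ℂ (ℂ ⊗[ℝ] CompactG2)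
      (ofReIm 0 ((2 : ℝ) • torusDer 1 2)))) := by
  have hinj : Function.Injective (torusMap.baseChange ℂ) :=
    Module.Flat.lTensor_preserves_injective_linearMap (M := ℂ) _ torusMap_injective
  have hle : LinearMap.range (torusMap.baseChange ℂ) ≤ LinearMap.ker
      (LieAlgebra.ad ℂ (ℂ ⊗[ℝ] CompactG2) (ofReIm 0 ((2 : ℝ) • torusDer 1 2))) := by
    rintro _ ⟨z, rfl⟩
    rw [LinearMap.mem_ker]
    induction z using TensorProduct.induction_on with
    | zero => rw [map_zero, map_zero]
    | add u v hu hv => rw [map_add, map_add, hu, hv, add_zero]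
    | tmul c p =>
      rw [LinearMap.baseChange_tmul, torusMap_apply, LieAlgebra.ad_apply, ofReIm,
        TensorProduct.tmul_zero, zero_add, LieAlgebra.ExtendScalars.bracket_tmul, smul_lie,
        lie_torusDer, smul_zero, TensorProduct.tmul_zero]
  have := Submodule.finrank_mono hle
  rwa [LinearMap.finrank_range_of_inj hinj, Module.finrank_baseChange, Module.finrank_prod,
    Module.finrank_self] at this

theorem isPrincipalTDS_subalgebra_standard : IsPrincipalTDS isSo3Triple_standard.subalgebra where
  finrank_eq := isSo3Triple_standard.finrank_subalgebra torusDer_ne_zero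
  isSimple := isSo3Triple_standard.isSimple_subalgebra torusDer_ne_zero
  isPrincipal := by
    have t := isSo3Triple_standard
    have hHY := lie_ofReIm_of_lie_eq t.lie_H_X (by rw [← lie_skew, t.lie_Y_H])
    refine ⟨_, _, _, t.isSl2Triple torusDer_ne_zero, ⟨?_, ?_⟩, span_ofReIm_triple _ _ _⟩
    · exact isNilpotent_of_lie_eq_two_nsmul (ad_mul_sub_mul_eq hHY)
    · rw [rank_complex]
      -- The complexified torus lies in the kernel of ad h, whose dimension bounds that of ker ad e
      -- from below.
      exact le_antisymm (finrank_ker_ad_principal rfl rfl)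
        (two_le_finrank_ker_ad.trans (finrank_ker_le_of_lie_eq_two_nsmul (ad_mul_sub_mul_eq hHY)))

end Octonion

theorem mainTheorem2 :
    (∃ s : LieSubalgebra ℝ CompactG2, IsPrincipalTDS s) ∧
      ∀ s s' : LieSubalgebra ℝ CompactG2, IsPrincipalTDS s → IsPrincipalTDS s' →
        ∃ φ : CompactG2 ≃ₗ⁅ℝ⁆ CompactG2, s.map φ.toLieHom = s' := by
  refine ⟨⟨_, Octonion.isPrincipalTDS_subalgebra_standard⟩, fun s s' hs hs' => ?_⟩
  obtain ⟨H, X, Y, t, hH, h⟩ := hs.exists_so3Triple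
  obtain ⟨H', X', Y', t', hH', h'⟩ := hs'.exists_so3Triple
  exact Octonion.exists_map_eq_of_so3Triple t hH h t' hH' h'
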